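/- **Setting.** Let $n,m\in\mathbb N$, $0\le t\le T$. Consider the state equation $$\dot X(s)=A(s,X(s))+B(s,X(s))u(s),\quad s\in[t,T],\qquad X(t)=x\in\mathbb R^n,$$ with controls $u\in\mathcal U[t,T]=L^2(t,T;\mathbb R^m)$, and the cost $$J(t,x;u)=\int_t^T\Big[Q(s,X(s))+\langle S(s,X(s)),u(s)\rangle+\tfrac12\langle R(s,X(s))u(s),u(s)\rangle\Big]ds+G(X(T)).$$ Vectors carry the Euclidean norm and matrices the operator norm. Assume: (H1) $A:[0,T]\times\mathbb R^n\to\mathbb R^n$ and $B:[0,T]\times\mathbb R^n\to\mathbb R^{n\times m}$ are continuous, and there are $L_A,L_B,\tilde L_B>0$ with $|A(s,x)-A(s,\bar x)|\le L_A|x-\bar x|$, $|B(s,x)-B(s,\bar x)|\le\tilde L_B|x-\bar x|$ and $\langle[B(s,x)-B(s,\bar x)]^T(x-\bar x),u\rangle\le L_B|x-\bar x|^2$ for all $s\in[0,T]$, $x,\bar x\in\mathbb R^n$, $u\in\mathbb R^m$. (H2) $Q:[0,T]\times\mathbb R^n\to\mathbb R$, $S:[0,T]\times\mathbb R^n\to\mathbb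 R^m$, $R:[0,T]\times\mathbb R^n\to\mathbb S^m$ (symmetric matrices) and $G:\mathbb R^n\to\mathbb R$ are continuous, and there are constants $L,Q_0,G_0,S_0,\rho_0>0$, $\varepsilon_0\in(0,1)$ and a continuous $\rho:\mathbb R^n\to[\rho_0,\infty)$ such that on $[0,T]\times\mathbb R^n$: $R\ge\rho(x)I$; $(1-\varepsilon_0)Q-\frac12S^TR^{-1}S\ge-L$; $G\ge-L$; $Q\le Q_0(1+|x|^2)$; $G\le G_0(1+|x|^2)$; $|S|\le S_0(1+|x|)$; $|A+BR^{-1}S|\le L(1+|x|)$; $|BR^{-1}B^T|\le L$. (H3) $A,B,Q,S,R,G$ are twice continuously differentiable (in $(s,x)$ on $[0,T]\times\mathbb R^n$). **Proposition 5.4.** Let (H1)–(H3) hold with $$A(s,x)=A(s)x,\quad B(s,x)=B(s),\quad S(s,x)=S(s)x,\quad R(s,x)=R(s)\qquad(s\in[0,T],\ x\in\mathbb R^n).$$ Let $\Phi_A$ be the fundamental matrix of $A(\cdot)$, i.e. $\frac{d}{ds}\Phi_A(s,\tau)=A(s)\Phi_A(s,\tau)$ for $t\le\tau\le s\le T$,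 $\Phi_A(\tau,\tau)=I$. Let $\alpha\in(0,1)$ and $\delta>0$, let $\bar G$ be a symmetric positive semidefinite $n\times n$ matrix and $\bar Q$ a map from $[0,T]$ to the symmetric positive semidefinite $n\times n$ matrices, and put $$\widehat G(t)=\Big[\int_t^T\!\!\int_t^T|B(s)^T\Phi_A(T,s)^T\bar G\,\Phi_A(T,r)B(r)|^2\,dr\,ds\Big]^{1/2},$$ $$\widehat Q(s,t)=\int_s^T\Big[\int_t^\tau\!\!\int_t^\tau|B(r)^T\Phi_A(\tau,r)^T\bar Q(\tau)\Phi_A(\tau,r')B(r')|^2\,dr'\,dr\Big]^{1/2}d\tau,$$ where the function of $\tau$ under the outer integral in $\widehat Q$ is assumed to be integrable on $[t,T]$. Suppose that $$Q_{xx}(s,x)+\bar Q(s)-\alpha^{-1}S(s)^TR(s)^{-1}S(s)\ge0,\qquad G_{xx}(x)+\bar G\ge0,\qquad (s,x)\in[t,T]\times\mathbb R^n,$$ $$(1-\alpha)R(s)-[\widehat G(t)+\widehat Q(s,t)]I\ge\delta I,\qquad s\in[t,T].$$ Then, for every $x\in\mathbb R^n$, the state equation has exactly one solution on $[t,T]$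 for each $u\in\mathcal U[t,T]$, the functional $u\mapsto J(t,x;u)$ is twice Fréchet differentiable on $\mathcal U[t,T]$, and its Hessian $D_{uu}J(t,x;u)$ is uniformly positive definite: $$\langle D_{uu}J(t,x;u)v,v\rangle_{L^2}\ge\delta\,\|v\|_{L^2}^2\qquad\text{for all }u,v\in\mathcal U[t,T].$$ -/

import Mathlib

open MeasureTheory Set

noncomputable section

/-- `ℝᵏ` with its Euclidean norm.  An `i × j` matrix is represented by the corresponding
continuous linear map `Vec j →L[ℝ] Vec i`; its norm is the operator norm and its transpose is the
adjoint. -/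
abbrev Vec (k : ℕ) : Type := EuclideanSpace ℝ (Fin k)

/-- Admissible controls on `[t, T]`: the Hilbert space `L²(t, T; ℝᵐ)` (the control set is the whole
of `ℝᵐ`). -/
abbrev Control (m : ℕ) (t T : ℝ) : Type :=
  Lp (Vec m) 2 ((volume : Measure ℝ).restrict (Icc t T))

/-- The coefficients of an affine-quadratic optimal control problem: state equation
`X' = A(s, X) + B(s, X) u`, running cost `Q(s, X) + ⟨S(s, X), u⟩ + ½ ⟨R(s, X) u, u⟩`,
terminal cost `G(X(T))`. -/
structure AQProblem (n m : ℕ) where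
  A : ℝ → Vec n → Vec n
  B : ℝ → Vec n → (Vec m →L[ℝ] Vec n)
  Q : ℝ → Vec n → ℝ
  S : ℝ → Vec n → Vec m
  R : ℝ → Vec n → (Vec m →L[ℝ] Vec m)
  G : Vec n → ℝ

namespace AQProblem

variable {n m : ℕ}

/-- Hypothesis (H1) on `[0, T]`, with control set `ℝᵐ`. -/
def H1 (P : AQProblem n m) (T : ℝ) : Prop :=
  ContinuousOn (fun p : ℝ × Vec n => P.A p.1 p.2) (Icc 0 T ×ˢ univ) ∧
  ContinuousOn (fun p : ℝ × Vec n => P.B p.1 p.2) (Icc 0 T ×ˢ univ) ∧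
  ∃ LA LB LB' : ℝ, 0 < LA ∧ 0 < LB ∧ 0 < LB' ∧
    ∀ s ∈ Icc 0 T, ∀ x y : Vec n,
      ‖P.A s x - P.A s y‖ ≤ LA * ‖x - y‖ ∧
      ‖P.B s x - P.B s y‖ ≤ LB' * ‖x - y‖ ∧
      ∀ u : Vec m,
        inner ℝ ((P.B s x - P.B s y).adjoint (x - y)) u ≤ LB * ‖x - y‖ ^ 2

/-- Hypothesis (H2) on `[0, T]`: continuity, symmetry of `R`, uniform positivity of `R`, and the
growth and lower bounds on the coefficients. -/
def H2 (P : AQProblem n m) (T : ℝ) : Prop :=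
  ContinuousOn (fun p : ℝ × Vec n => P.Q p.1 p.2) (Icc 0 T ×ˢ univ) ∧
  ContinuousOn (fun p : ℝ × Vec n => P.S p.1 p.2) (Icc 0 T ×ˢ univ) ∧
  ContinuousOn (fun p : ℝ × Vec n => P.R p.1 p.2) (Icc 0 T ×ˢ univ) ∧
  Continuous P.G ∧
  (∀ s ∈ Icc 0 T, ∀ x : Vec n, IsSelfAdjoint (P.R s x)) ∧
  ∃ (L Q₀ G₀ S₀ ε₀ ρ₀ : ℝ) (ρ : Vec n → ℝ),
    0 < L ∧ 0 < Q₀ ∧ 0 < G₀ ∧ 0 < S₀ ∧ 0 < ε₀ ∧ ε₀ < 1 ∧ 0 < ρ₀ ∧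
    Continuous ρ ∧ (∀ x, ρ₀ ≤ ρ x) ∧
    ∀ s ∈ Icc 0 T, ∀ x : Vec n,
      (∀ w : Vec m, ρ x * ‖w‖ ^ 2 ≤ inner ℝ (P.R s x w) w) ∧
      -L ≤ (1 - ε₀) * P.Q s x - 1 / 2 * inner ℝ ((P.R s x).inverse (P.S s x)) (P.S s x) ∧
      -L ≤ P.G x ∧
      P.Q s x ≤ Q₀ * (1 + ‖x‖ ^ 2) ∧
      P.G x ≤ G₀ * (1 + ‖x‖ ^ 2) ∧
      ‖P.S s x‖ ≤ S₀ * (1 + ‖x‖) ∧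
      ‖P.A s x + P.B s x ((P.R s x).inverse (P.S s x))‖ ≤ L * (1 + ‖x‖) ∧
      ‖P.B s x ∘L (P.R s x).inverse ∘L (P.B s x).adjoint‖ ≤ L

/-- Hypothesis (H3): all coefficients are twice continuously differentiable on `[0, T] × ℝⁿ`. -/
def H3 (P : AQProblem n m) (T : ℝ) : Prop :=
  ContDiffOn ℝ 2 (fun p : ℝ × Vec n => P.A p.1 p.2) (Icc 0 T ×ˢ univ) ∧
  ContDiffOn ℝ 2 (fun p : ℝ × Vec n => P.B p.1 p.2) (Icc 0 T ×ˢ univ) ∧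
  ContDiffOn ℝ 2 (fun p : ℝ × Vec n => P.Q p.1 p.2) (Icc 0 T ×ˢ univ) ∧
  ContDiffOn ℝ 2 (fun p : ℝ × Vec n => P.S p.1 p.2) (Icc 0 T ×ˢ univ) ∧
  ContDiffOn ℝ 2 (fun p : ℝ × Vec n => P.R p.1 p.2) (Icc 0 T ×ˢ univ) ∧
  ContDiff ℝ 2 P.G

/-- `X` solves `X' = A(s, X) + B(s, X) u` on `[t, T]` with `X(t) = x`, in the (Carathéodory)
integral sense. -/
def IsTrajectory (P : AQProblem n m) (t T : ℝ) (x : Vec n) (u : Control m t T)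
    (X : ℝ → Vec n) : Prop :=
  ContinuousOn X (Icc t T) ∧
  IntervalIntegrable (fun r => P.A r (X r) + P.B r (X r) (u r)) volume t T ∧
  ∀ s ∈ Icc t T, X s = x + ∫ r in t..s, (P.A r (X r) + P.B r (X r) (u r))

open Classical in
/-- The state trajectory `X(·; t, x, u)`; only its values on `[t, T]` matter. -/
def trajectory (P : AQProblem n m) (t T : ℝ) (x : Vec n) (u : Control m t T) : ℝ → Vec n :=
  if h : ∃ X, P.IsTrajectory t T x u X then h.choose else 0

/-- The cost functional `J(t, x; u)`. -/
def cost (P : AQProblem n m) (t T : ℝ) (x : Vec n) (u : Control m t T) : ℝ :=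
  (∫ s in t..T,
    (P.Q s (P.trajectory t T x u s) + inner ℝ (P.S s (P.trajectory t T x u s)) (u s)
      + 1 / 2 * inner ℝ (P.R s (P.trajectory t T x u s) (u s)) (u s)))
    + P.G (P.trajectory t T x u T)

/-- `D_u J(t, x; u)`, as an element of `L²(t, T; ℝᵐ)` (Fréchet derivative and Riesz
representation). -/
def DuJ (P : AQProblem n m) (t T : ℝ) (x : Vec n) (u : Control m t T) : Control m t T :=
  gradient (P.cost t T x) u

/-- `D_uu J(t, x; u)`, the Fréchet derivative of `u ↦ D_u J(t, x; u)`: a bounded linear operator on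
`L²(t, T; ℝᵐ)`. -/
def DuuJ (P : AQProblem n m) (t T : ℝ) (x : Vec n) (u : Control m t T) :
    Control m t T →L[ℝ] Control m t T :=
  fderiv ℝ (P.DuJ t T x) u

end AQProblem

/-- `Φ(s, τ)`, `t ≤ τ ≤ s ≤ T`, is the fundamental matrix of `A(·)` on `[t, T]`:
`∂Φ/∂s (s, τ) = A(s) Φ(s, τ)` and `Φ(τ, τ) = I`. -/
def IsFundamentalMatrix {n : ℕ} (A : ℝ → (Vec n →L[ℝ] Vec n)) (t T : ℝ)
    (Φ : ℝ → ℝ → (Vec n →L[ℝ] Vec n)) : Prop :=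
  ∀ τ ∈ Icc t T, Φ τ τ = ContinuousLinearMap.id ℝ (Vec n) ∧
    ∀ s ∈ Icc τ T, HasDerivWithinAt (fun σ => Φ σ τ) (A s ∘L Φ s τ) (Icc τ T) s

open Classical in
/-- The fundamental matrix `Φ_A(s, τ)` of `A(·)` on `[t, T]`; only its values at
`t ≤ τ ≤ s ≤ T` matter. -/
def fundamentalMatrix {n : ℕ} (A : ℝ → (Vec n →L[ℝ] Vec n)) (t T : ℝ) :
    ℝ → ℝ → (Vec n →L[ℝ] Vec n) :=
  if h : ∃ Φ, IsFundamentalMatrix A t T Φ then h.choose else 0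

/-- `[∫_t^τ ∫_t^τ |B(r)ᵀ Φ_A(τ, r)ᵀ M Φ_A(τ, r') B(r')|² dr' dr]^{1/2}`. -/
def kernelNorm {n m : ℕ} (A : ℝ → (Vec n →L[ℝ] Vec n)) (B : ℝ → (Vec m →L[ℝ] Vec n)) (t T : ℝ)
    (M : Vec n →L[ℝ] Vec n) (τ : ℝ) : ℝ :=
  √(∫ r in t..τ, ∫ r' in t..τ,
    ‖(B r).adjoint ∘L (fundamentalMatrix A t T τ r).adjoint ∘L M ∘L
      fundamentalMatrix A t T τ r' ∘L B r'‖ ^ 2)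

/-- `Ĝ(t)`. -/
def GHat {n m : ℕ} (A : ℝ → (Vec n →L[ℝ] Vec n)) (B : ℝ → (Vec m →L[ℝ] Vec n)) (t T : ℝ)
    (Gbar : Vec n →L[ℝ] Vec n) : ℝ :=
  kernelNorm A B t T Gbar T

/-- `Q̂(s, t)`. -/
def QHat {n m : ℕ} (A : ℝ → (Vec n →L[ℝ] Vec n)) (B : ℝ → (Vec m →L[ℝ] Vec n)) (t T : ℝ)
    (Qbar : ℝ → (Vec n →L[ℝ] Vec n)) (s : ℝ) : ℝ :=
  ∫ τ in s..T, kernelNorm A B t T (Qbar τ) τ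

/-- The quadratic form `⟨f_xx(x) h, h⟩` of the Hessian of `f : ℝⁿ → ℝ`. -/
def hessianForm {n : ℕ} (f : Vec n → ℝ) (x h : Vec n) : ℝ :=
  fderiv ℝ (fderiv ℝ f) x h h

end

/-!
The state is an affine function of the control, `X = X₀ + Y u` with
`Y s u = ∫_t^s Φ_A(s, r) B(r) u(r) dr`, so the second variation of the cost in the direction `v` is
that of the coefficients along `y = Y v`. Semi-convexity together with
`2⟨S y, v⟩ + α⟨R v, v⟩ + α⁻¹⟨R⁻¹ S y, S y⟩ ≥ 0` reduces its positivity to bounding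
`∫ ⟨Q̄ y, y⟩ + ⟨Ḡ y(T), y(T)⟩`. Each of these quadratic forms is an integral operator in `v`,
hence at most its Hilbert–Schmidt norm times `∫_t^s ‖v‖²`. Exchanging the order of integration turns
these norms into the weights `Q̂(s, t)` and `Ĝ(t)`, which `(1 - α) R` dominates with margin `δ`.
-/

section LinearODE

theorem intervalIntegrable_of_continuousOn_Icc {E : Type*} [NormedAddCommGroup E] {f : ℝ → E}
    {a b r s : ℝ} (hf : ContinuousOn f (Icc a b)) (hr : r ∈ Icc a b) (hs : s ∈ Icc a b) :
    IntervalIntegrable f volume r s :=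
  (hf.mono (uIcc_subset_Icc hr hs)).intervalIntegrable

variable {E : Type*} [NormedAddCommGroup E] [NormedSpace ℝ E] {a b : ℝ}

theorem hasDerivWithinAt_const_add_integral_Icc [CompleteSpace E] {f : ℝ → E}
    (hf : ContinuousOn f (Icc a b)) (c : E) {s : ℝ} (hs : s ∈ Icc a b) :
    HasDerivWithinAt (fun σ => c + ∫ r in a..σ, f r) (f s) (Icc a b) s :=
  ODE.hasDerivWithinAt_picard_Icc (f := fun r _ => f r) (α := fun _ => (0 : E)) (u := univ)
    (left_mem_Icc.2 (hs.1.trans hs.2)) (hf.comp continuousOn_fst fun _ hp => hp.1)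
    continuousOn_const (fun _ _ => mem_univ _) c hs

theorem integral_eq_sub_of_hasDerivWithinAt_Icc [CompleteSpace E] {f f' : ℝ → E}
    (hf : ∀ s ∈ Icc a b, HasDerivWithinAt f (f' s) (Icc a b) s)
    (hf' : ContinuousOn f' (Icc a b)) {r s : ℝ} (hr : a ≤ r) (hrs : r ≤ s) (hs : s ≤ b) :
    ∫ σ in r..s, f' σ = f s - f r := by
  have hsub : Icc r s ⊆ Icc a b := Icc_subset_Icc hr hs
  refine intervalIntegral.integral_eq_sub_of_hasDerivAt_of_le hrs
    (fun σ hσ => ((hf σ (hsub hσ)).mono hsub).continuousWithinAt) (fun σ hσ => ?_)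
    (hf'.mono ((uIcc_of_le hrs).trans_subset hsub)).intervalIntegrable
  exact (hf σ (hsub (Ioo_subset_Icc_self hσ))).hasDerivAt
    (Icc_mem_nhds (hr.trans_lt hσ.1) (hσ.2.trans_le hs))

theorem eqOn_zero_of_hasDerivWithinAt_linear {L : ℝ → E →L[ℝ] E} (hL : ContinuousOn L (Icc a b))
    {f : ℝ → E} (hf : ∀ s ∈ Icc a b, HasDerivWithinAt f (L s (f s)) (Icc a b) s) (ha : f a = 0) :
    EqOn f 0 (Icc a b) := by
  obtain ⟨M, hM⟩ := isCompact_Icc.exists_bound_of_continuousOn hL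
  exact eq_zero_of_abs_deriv_le_mul_abs_self_of_eq_zero_right
    (fun s hs => (hf s hs).continuousWithinAt)
    (fun s hs => (hf s (Ico_subset_Icc_self hs)).mono_of_mem_nhdsWithin (Icc_mem_nhdsGE_of_mem hs))
    ha fun s hs => (L s).le_of_opNorm_le (hM s (Ico_subset_Icc_self hs)) _

theorem norm_integral_exp_smul_le {g : ℝ → E} {k C s : ℝ} (hk : 0 < k) (hC : 0 ≤ C) (has : a ≤ s)
    (hg : ∀ r ∈ Ioc a s, ‖g r‖ ≤ C) :
    ‖∫ r in a..s, Real.exp (k * r) • g r‖ ≤ Real.exp (k * s) * (C / k) := by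
  have hexp : Continuous fun r => C * Real.exp (k * r) := by fun_prop
  calc ‖∫ r in a..s, Real.exp (k * r) • g r‖
      ≤ ∫ r in a..s, C * Real.exp (k * r) := by
        refine intervalIntegral.norm_integral_le_of_norm_le has (ae_of_all _ fun r hr => ?_)
          (hexp.intervalIntegrable _ _)
        rw [norm_smul, Real.norm_of_nonneg (Real.exp_pos _).le, mul_comm]
        exact mul_le_mul_of_nonneg_right (hg r hr) (Real.exp_pos _).le
    _ = (Real.exp (k * s) - Real.exp (k * a)) * (C / k) := by
        simp only [intervalIntegral.integral_const_mul, ne_eq, hk.ne', not_false_eq_true,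
          intervalIntegral.integral_comp_mul_left, integral_exp, smul_eq_mul, div_eq_mul_inv]
        ring
    _ ≤ Real.exp (k * s) * (C / k) := by
        gcongr
        exact sub_le_self _ (Real.exp_pos _).le

/-- The Picard operator of `y' = L y`, `y(a) = y₀`, conjugated by the weight `exp (k s)`: for large
`k` it is a contraction on the whole interval.  A fixed point `z` gives the solution
`y s = exp (k s) • z s`. -/
noncomputable def weightedPicard (L : ℝ → E →L[ℝ] E) (a k : ℝ) (y₀ : E) (z : ℝ → E) (s : ℝ) : E :=
  Real.exp (-(k * s)) • (y₀ + ∫ r in a..s, Real.exp (k * r) • L r (z r))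

theorem exp_smul_weightedPicard (L : ℝ → E →L[ℝ] E) (k : ℝ) (y₀ : E) (z : ℝ → E) (s : ℝ) :
    Real.exp (k * s) • weightedPicard L a k y₀ z s
      = y₀ + ∫ r in a..s, Real.exp (k * r) • L r (z r) := by
  rw [weightedPicard, smul_smul, ← Real.exp_add, add_neg_cancel, Real.exp_zero, one_smul]

theorem continuousOn_exp_smul_clm_apply {L : ℝ → E →L[ℝ] E} (hL : ContinuousOn L (Icc a b)) (k : ℝ)
    {z : ℝ → E} (hz : ContinuousOn z (Icc a b)) :
    ContinuousOn (fun r => Real.exp (k * r) • L r (z r)) (Icc a b) :=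
  (by fun_prop : Continuous fun r => Real.exp (k * r)).continuousOn.smul (hL.clm_apply hz)

theorem continuousOn_weightedPicard [CompleteSpace E] {L : ℝ → E →L[ℝ] E}
    (hL : ContinuousOn L (Icc a b)) (k : ℝ) (y₀ : E) {z : ℝ → E} (hz : ContinuousOn z (Icc a b)) :
    ContinuousOn (weightedPicard L a k y₀ z) (Icc a b) :=
  (by fun_prop : Continuous fun s => Real.exp (-(k * s))).continuousOn.smul fun _ hs =>
    (hasDerivWithinAt_const_add_integral_Icc (continuousOn_exp_smul_clm_apply hL k hz) y₀
      hs).continuousWithinAt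

theorem norm_weightedPicard_sub_le {L : ℝ → E →L[ℝ] E} (hL : ContinuousOn L (Icc a b)) {M k D : ℝ}
    (hM : ∀ s ∈ Icc a b, ‖L s‖ ≤ M) (hk : 0 < k) (y₀ : E) {z w : ℝ → E}
    (hz : ContinuousOn z (Icc a b)) (hw : ContinuousOn w (Icc a b))
    (hD : ∀ s ∈ Icc a b, ‖z s - w s‖ ≤ D) {s : ℝ} (hs : s ∈ Icc a b) :
    ‖weightedPicard L a k y₀ z s - weightedPicard L a k y₀ w s‖ ≤ M * D / k := by
  have ha : a ∈ Icc a b := left_mem_Icc.2 (hs.1.trans hs.2)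
  have hMD : 0 ≤ M * D :=
    mul_nonneg ((norm_nonneg _).trans (hM s hs)) ((norm_nonneg _).trans (hD s hs))
  have hdiff : weightedPicard L a k y₀ z s - weightedPicard L a k y₀ w s
      = Real.exp (-(k * s)) • ∫ r in a..s, Real.exp (k * r) • L r (z r - w r) := by
    rw [weightedPicard, weightedPicard, ← smul_sub, add_sub_add_left_eq_sub,
      ← intervalIntegral.integral_sub]
    · simp only [map_sub, smul_sub]
    · exact intervalIntegrable_of_continuousOn_Icc (continuousOn_exp_smul_clm_apply hL k hz) ha hs
    · exact intervalIntegrable_of_continuousOn_Icc (continuousOn_exp_smul_clm_apply hL k hw) ha hs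
  rw [hdiff, norm_smul, Real.norm_of_nonneg (Real.exp_pos _).le, Real.exp_neg,
    inv_mul_le_iff₀ (Real.exp_pos _)]
  refine norm_integral_exp_smul_le hk hMD hs.1 fun r hr => ?_
  have hr' : r ∈ Icc a b := ⟨hr.1.le, hr.2.trans hs.2⟩
  exact (L r).le_of_opNorm_le_of_le (hM r hr') (hD r hr')

theorem exists_weightedPicard_fixedPoint [CompleteSpace E] {L : ℝ → E →L[ℝ] E} (hab : a ≤ b)
    (hL : ContinuousOn L (Icc a b)) (y₀ : E) :
    ∃ (k : ℝ) (z : ℝ → E), ContinuousOn z (Icc a b) ∧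
      ∀ s ∈ Icc a b, weightedPicard L a k y₀ z s = z s := by
  obtain ⟨M, hM⟩ := isCompact_Icc.exists_bound_of_continuousOn hL
  have hM0 : 0 ≤ M := (norm_nonneg _).trans (hM a (left_mem_Icc.2 hab))
  have hk : 0 < 2 * M + 1 := by positivity
  have hext (z : C(Icc a b, E)) : ContinuousOn (IccExtend hab z) (Icc a b) :=
    z.continuous.Icc_extend'.continuousOn
  let Φ (z : C(Icc a b, E)) : C(Icc a b, E) :=
    ⟨_, continuousOn_iff_continuous_domRestrict.1
      (continuousOn_weightedPicard hL (2 * M + 1) y₀ (hext z))⟩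
  have hΦ : ContractingWith (1 / 2) Φ := by
    refine ⟨by rw [← NNReal.coe_lt_coe]; norm_num, LipschitzWith.of_dist_le_mul fun z w => ?_⟩
    rw [dist_eq_norm, dist_eq_norm, ContinuousMap.norm_le _ (by positivity)]
    refine fun s => (norm_weightedPicard_sub_le hL hM hk y₀ (hext z) (hext w)
      (fun r _ => (z - w).norm_coe_le_norm (projIcc a b hab r)) s.2).trans ?_
    rw [div_le_iff₀ hk]
    push_cast
    nlinarith [norm_nonneg (z - w)]
  obtain ⟨z, hz⟩ : ∃ z, Φ z = z := ⟨_, hΦ.fixedPoint_isFixedPt⟩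
  refine ⟨2 * M + 1, IccExtend hab z, hext z, fun s hs => ?_⟩
  rw [IccExtend_of_mem hab _ hs]
  exact congrArg (fun f => f ⟨s, hs⟩) hz

theorem exists_hasDerivWithinAt_linear [CompleteSpace E] {L : ℝ → E →L[ℝ] E} (hab : a ≤ b)
    (hL : ContinuousOn L (Icc a b)) (y₀ : E) :
    ∃ y : ℝ → E, y a = y₀ ∧ ∀ s ∈ Icc a b, HasDerivWithinAt y (L s (y s)) (Icc a b) s := by
  obtain ⟨k, z, hz, hfix⟩ := exists_weightedPicard_fixedPoint hab hL y₀
  refine ⟨fun s => y₀ + ∫ r in a..s, Real.exp (k * r) • L r (z r), by simp, fun s hs => ?_⟩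
  have hderiv := hasDerivWithinAt_const_add_integral_Icc
    (continuousOn_exp_smul_clm_apply hL k hz) y₀ hs
  rwa [← map_smul, ← hfix s hs, exp_smul_weightedPicard] at hderiv

end LinearODE

section FundamentalPair

variable {𝔸 : Type*} [NormedRing 𝔸] [NormedAlgebra ℝ 𝔸]

/-- `Ψ` is the fundamental solution `Ψ' = A Ψ`, `Ψ(a) = 1`, on `[a, b]`, and `Ξ` is a pointwise
right inverse of it.  The transition operator from `r` to `s` is then `Ψ s * Ξ r`. -/
structure IsFundamentalPair (A : ℝ → 𝔸) (a b : ℝ) (Ψ Ξ : ℝ → 𝔸) : Prop where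
  left_eq_one : Ψ a = 1
  hasDerivWithinAt : ∀ s ∈ Icc a b, HasDerivWithinAt Ψ (A s * Ψ s) (Icc a b) s
  continuousOn_inv : ContinuousOn Ξ (Icc a b)
  mul_inv : ∀ s ∈ Icc a b, Ψ s * Ξ s = 1

theorem IsFundamentalPair.continuousOn {A Ψ Ξ : ℝ → 𝔸} {a b : ℝ}
    (h : IsFundamentalPair A a b Ψ Ξ) : ContinuousOn Ψ (Icc a b) :=
  fun s hs => (h.hasDerivWithinAt s hs).continuousWithinAt

theorem exists_isFundamentalPair [CompleteSpace 𝔸] {A : ℝ → 𝔸} {a b : ℝ} (hab : a ≤ b)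
    (hA : ContinuousOn A (Icc a b)) : ∃ Ψ Ξ, IsFundamentalPair A a b Ψ Ξ := by
  have hleft : ContinuousOn (fun s => ContinuousLinearMap.mul ℝ 𝔸 (A s)) (Icc a b) :=
    (ContinuousLinearMap.mul ℝ 𝔸).continuous.comp_continuousOn hA
  have hright : ContinuousOn (fun s => (ContinuousLinearMap.mul ℝ 𝔸).flip (A s)) (Icc a b) :=
    (ContinuousLinearMap.mul ℝ 𝔸).flip.continuous.comp_continuousOn hA
  obtain ⟨Ψ, hΨa, hΨ⟩ := exists_hasDerivWithinAt_linear hab hleft 1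
  obtain ⟨Ξ, hΞa, hΞ⟩ := exists_hasDerivWithinAt_linear hab hright.neg 1
  have hΨΞ : ∀ s ∈ Icc a b, Ψ s * Ξ s = 1 := fun s hs => sub_eq_zero.1 <|
    eqOn_zero_of_hasDerivWithinAt_linear (f := fun s => Ψ s * Ξ s - 1) (hleft.sub hright)
      (fun r hr => (((hΨ r hr).mul (hΞ r hr)).sub_const 1).congr_deriv
        (show A r * Ψ r * Ξ r + Ψ r * -(Ξ r * A r)
            = A r * (Ψ r * Ξ r - 1) - (Ψ r * Ξ r - 1) * A r by noncomm_ring))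
      (by simp [hΨa, hΞa]) hs
  exact ⟨Ψ, Ξ, hΨa, hΨ, fun s hs => (hΞ s hs).continuousWithinAt, hΨΞ⟩

end FundamentalPair

section VariationOfConstants

theorem intervalIntegrable_of_integrableOn_Icc {E : Type*} [NormedAddCommGroup E] {g : ℝ → E}
    {a b r s : ℝ} (hg : IntegrableOn g (Icc a b)) (hr : r ∈ Icc a b) (hs : s ∈ Icc a b) :
    IntervalIntegrable g volume r s :=
  intervalIntegrable_iff.2 (hg.mono_set (uIoc_subset_uIcc.trans (uIcc_subset_Icc hr hs)))

variable {E F : Type*} [NormedAddCommGroup E] [NormedSpace ℝ E] [NormedAddCommGroup F]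
  [NormedSpace ℝ F] {a b : ℝ}

theorem integrableOn_clm_apply_of_continuousOn {C : ℝ → E →L[ℝ] F} (hC : ContinuousOn C (Icc a b))
    {g : ℝ → E} (hg : IntegrableOn g (Icc a b)) : IntegrableOn (fun r => C r (g r)) (Icc a b) := by
  obtain ⟨M, hM⟩ := isCompact_Icc.exists_bound_of_continuousOn hC
  exact (ContinuousLinearMap.id ℝ (E →L[ℝ] F)).integrable_of_bilin_of_bdd_left M
    (hC.aestronglyMeasurable measurableSet_Icc) ((ae_restrict_iff' measurableSet_Icc).2
      (ae_of_all _ hM)) hg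

theorem continuousOn_primitive_Icc (hab : a ≤ b) {g : ℝ → E} (hg : IntegrableOn g (Icc a b)) :
    ContinuousOn (fun s => ∫ r in a..s, g r) (Icc a b) := by
  rw [← uIcc_of_le hab] at hg ⊢
  exact intervalIntegral.continuousOn_primitive_interval hg

theorem integral_integral_triangle (hab : a ≤ b) {f : ℝ → ℝ → E}
    (hf : Integrable (Function.uncurry f)
      ((volume.restrict (Ioc a b)).prod (volume.restrict (Ioc a b)))) :
    ∫ s in a..b, ∫ r in a..s, f s r = ∫ r in a..b, ∫ s in r..b, f s r := by
  let D : Set (ℝ × ℝ) := {p | p.2 ≤ p.1}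
  have hD : MeasurableSet D := measurableSet_le measurable_snd measurable_fst
  have hleft : ∀ s ∈ Ioc a b,
      ∫ r in a..s, f s r = ∫ r in Ioc a b, D.indicator (Function.uncurry f) (s, r) := by
    intro s hs
    have hslice : (fun r => D.indicator (Function.uncurry f) (s, r)) = (Iic s).indicator (f s) := by
      ext r; simp [D, indicator]
    rw [hslice, setIntegral_indicator measurableSet_Iic, Ioc_inter_Iic, min_eq_right hs.2,
      intervalIntegral.integral_of_le hs.1.le]
  have hright : ∀ r ∈ Ioc a b,
      ∫ s in r..b, f s r = ∫ s in Ioc a b, D.indicator (Function.uncurry f) (s, r) := by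
    intro r hr
    have hslice : (fun s => D.indicator (Function.uncurry f) (s, r))
        = (Ici r).indicator fun s => f s r := by
      ext s; simp [D, indicator]
    have hinter : Ioc a b ∩ Ici r = Icc r b := by
      ext s
      exact ⟨fun h => ⟨h.2, h.1.2⟩, fun h => ⟨⟨hr.1.trans_le h.1, h.2⟩, h.1⟩⟩
    rw [hslice, setIntegral_indicator measurableSet_Ici, hinter, integral_Icc_eq_integral_Ioc,
      intervalIntegral.integral_of_le hr.2]
  rw [intervalIntegral.integral_of_le hab, intervalIntegral.integral_of_le hab,
    setIntegral_congr_fun measurableSet_Ioc hleft, setIntegral_congr_fun measurableSet_Ioc hright]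
  exact integral_integral_swap (hf.indicator hD)

theorem integral_deriv_clm_apply_primitive [CompleteSpace E] [CompleteSpace F]
    {L L' : ℝ → E →L[ℝ] F} (hL : ∀ s ∈ Icc a b, HasDerivWithinAt L (L' s) (Icc a b) s)
    (hL' : ContinuousOn L' (Icc a b)) {g : ℝ → E} (hg : IntegrableOn g (Icc a b)) {s : ℝ}
    (hs : s ∈ Icc a b) :
    ∫ σ in a..s, L' σ (∫ r in a..σ, g r) = L s (∫ r in a..s, g r) - ∫ r in a..s, L r (g r) := by
  have ha : a ∈ Icc a b := left_mem_Icc.2 (hs.1.trans hs.2)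
  have hsub : Icc a s ⊆ Icc a b := Icc_subset_Icc_right hs.2
  have hLg : IntegrableOn (fun r => L r (g r)) (Icc a b) :=
    integrableOn_clm_apply_of_continuousOn (fun r hr => (hL r hr).continuousWithinAt) hg
  have hprod : Integrable (Function.uncurry fun σ r => L' σ (g r))
      ((volume.restrict (Ioc a s)).prod (volume.restrict (Ioc a s))) :=
    Integrable.op_fst_snd (op := fun (K : E →L[ℝ] F) v => K v)
      isBoundedBilinearMap_apply.continuous
      ⟨1, fun K v => by simpa using K.le_opNorm v⟩
      (((hL'.mono hsub).integrableOn_Icc).mono_set Ioc_subset_Icc_self)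
      (hg.mono_set (Ioc_subset_Icc_self.trans hsub))
  have hcomm : ∀ K : E →L[ℝ] F, ∀ σ ∈ Icc a b, K (∫ r in a..σ, g r) = ∫ r in a..σ, K (g r) :=
    fun K σ hσ =>
      (K.intervalIntegral_comp_comm (intervalIntegrable_of_integrableOn_Icc hg ha hσ)).symm
  calc ∫ σ in a..s, L' σ (∫ r in a..σ, g r)
      = ∫ σ in a..s, ∫ r in a..σ, L' σ (g r) :=
        intervalIntegral.integral_congr fun σ hσ =>
          hcomm _ σ (hsub (uIcc_of_le hs.1 ▸ hσ))
    _ = ∫ r in a..s, ∫ σ in r..s, L' σ (g r) := integral_integral_triangle hs.1 hprod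
    _ = ∫ r in a..s, (L s (g r) - L r (g r)) := by
        refine intervalIntegral.integral_congr fun r hr => ?_
        have hr : r ∈ Icc a s := uIcc_of_le hs.1 ▸ hr
        change ∫ σ in r..s, L' σ (g r) = _
        rw [← ContinuousLinearMap.intervalIntegral_apply
            (intervalIntegrable_of_continuousOn_Icc hL' (hsub hr) hs),
          integral_eq_sub_of_hasDerivWithinAt_Icc hL hL' hr.1 hr.2 hs.2, sub_apply]
    _ = L s (∫ r in a..s, g r) - ∫ r in a..s, L r (g r) := by
        rw [hcomm _ s hs, intervalIntegral.integral_sub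
          (intervalIntegrable_of_integrableOn_Icc ((L s).integrable_comp hg) ha hs)
          (intervalIntegrable_of_integrableOn_Icc hLg ha hs)]

theorem IsFundamentalPair.variation_of_constants [CompleteSpace E] {A Ψ Ξ : ℝ → E →L[ℝ] E}
    (h : IsFundamentalPair A a b Ψ Ξ) (hA : ContinuousOn A (Icc a b)) {g : ℝ → E}
    (hg : IntegrableOn g (Icc a b)) (x : E) {s : ℝ} (hs : s ∈ Icc a b) :
    Ψ s (x + ∫ r in a..s, Ξ r (g r))
      = x + ∫ r in a..s, (A r (Ψ r (x + ∫ σ in a..r, Ξ σ (g σ))) + g r) := by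
  have hab : a ≤ b := hs.1.trans hs.2
  have ha : a ∈ Icc a b := left_mem_Icc.2 hab
  have hΞg := integrableOn_clm_apply_of_continuousOn h.continuousOn_inv hg
  have hΨ' : ContinuousOn (fun r => A r * Ψ r) (Icc a b) := hA.mul h.continuousOn
  have hx : ∫ r in a..s, (A r * Ψ r) x = Ψ s x - x := by
    rw [← ContinuousLinearMap.intervalIntegral_apply
        (intervalIntegrable_of_continuousOn_Icc hΨ' ha hs),
      integral_eq_sub_of_hasDerivWithinAt_Icc h.hasDerivWithinAt hΨ' le_rfl hs.1 hs.2,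
      h.left_eq_one, sub_apply, one_apply_eq_self]
  have hΨΞg : ∫ r in a..s, Ψ r (Ξ r (g r)) = ∫ r in a..s, g r :=
    intervalIntegral.integral_congr fun r hr => by
      have hr : r ∈ Icc a b := ⟨(uIcc_of_le hs.1 ▸ hr).1, (uIcc_of_le hs.1 ▸ hr).2.trans hs.2⟩
      exact DFunLike.congr_fun (h.mul_inv r hr) (g r)
  have hw : ContinuousOn (fun r => ∫ σ in a..r, Ξ σ (g σ)) (Icc a b) :=
    continuousOn_primitive_Icc hab hΞg
  have hsplit (r : ℝ) : A r (Ψ r (x + ∫ σ in a..r, Ξ σ (g σ))) + g r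
      = (A r * Ψ r) x + (A r * Ψ r) (∫ σ in a..r, Ξ σ (g σ)) + g r := by
    rw [← map_add, mul_apply_eq_comp]
  have hi₁ := intervalIntegrable_of_continuousOn_Icc
    (hΨ'.clm_apply (continuousOn_const (c := x))) ha hs
  have hi₂ := intervalIntegrable_of_continuousOn_Icc (hΨ'.clm_apply hw) ha hs
  simp only [hsplit]
  rw [intervalIntegral.integral_add (hi₁.add hi₂) (intervalIntegrable_of_integrableOn_Icc hg ha hs),
    intervalIntegral.integral_add hi₁ hi₂, hx,
    integral_deriv_clm_apply_primitive h.hasDerivWithinAt hΨ' hΞg hs, hΨΞg, map_add]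
  abel

end VariationOfConstants

section FundamentalMatrix

variable {n : ℕ} {A Ψ Ξ : ℝ → Vec n →L[ℝ] Vec n} {t T : ℝ}

theorem IsFundamentalPair.isFundamentalMatrix (h : IsFundamentalPair A t T Ψ Ξ) :
    IsFundamentalMatrix A t T fun s τ => Ψ s * Ξ τ :=
  fun τ hτ => ⟨h.mul_inv τ hτ, fun s hs =>
    (((h.hasDerivWithinAt s ⟨hτ.1.trans hs.1, hs.2⟩).mono (Icc_subset_Icc_left hτ.1)).mul_const
      (Ξ τ)).congr_deriv (mul_assoc _ _ _)⟩

theorem IsFundamentalMatrix.eq (hA : ContinuousOn A (Icc t T)) {Φ Φ' : ℝ → ℝ → Vec n →L[ℝ] Vec n}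
    (h : IsFundamentalMatrix A t T Φ) (h' : IsFundamentalMatrix A t T Φ') {s τ : ℝ} (hτ : t ≤ τ)
    (hτs : τ ≤ s) (hs : s ≤ T) : Φ s τ = Φ' s τ := by
  obtain ⟨hid, hderiv⟩ := h τ ⟨hτ, hτs.trans hs⟩
  obtain ⟨hid', hderiv'⟩ := h' τ ⟨hτ, hτs.trans hs⟩
  have hcomp : ContinuousOn (fun s => ContinuousLinearMap.compL ℝ (Vec n) (Vec n) (Vec n) (A s))
      (Icc τ T) :=
    (ContinuousLinearMap.compL ℝ _ _ _).continuous.comp_continuousOn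
      (hA.mono (Icc_subset_Icc_left hτ))
  exact sub_eq_zero.1 <| eqOn_zero_of_hasDerivWithinAt_linear (f := fun s => Φ s τ - Φ' s τ) hcomp
    (fun r hr => ((hderiv r hr).sub (hderiv' r hr)).congr_deriv
      (mul_sub (A r) (Φ r τ) (Φ' r τ)).symm) (by simp [hid, hid']) ⟨hτs, hs⟩

theorem IsFundamentalPair.fundamentalMatrix_eq (h : IsFundamentalPair A t T Ψ Ξ)
    (hA : ContinuousOn A (Icc t T)) {s τ : ℝ} (hτ : t ≤ τ) (hτs : τ ≤ s) (hs : s ≤ T) :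
    fundamentalMatrix A t T s τ = Ψ s ∘L Ξ τ := by
  have hex : ∃ Φ, IsFundamentalMatrix A t T Φ := ⟨_, h.isFundamentalMatrix⟩
  rw [fundamentalMatrix, dif_pos hex]
  exact hex.choose_spec.eq hA h.isFundamentalMatrix hτ hτs hs

end FundamentalMatrix

section IntegralOperators

open Filter Topology

theorem integrableOn_Icc_Lp_two {E : Type*} [NormedAddCommGroup E] {a b : ℝ}
    (u : Lp E 2 (volume.restrict (Icc a b))) : IntegrableOn u (Icc a b) :=
  (Lp.memLp u).integrable one_le_two

theorem continuous_indicatorConstLp_Iic {E : Type*} [NormedAddCommGroup E] {a b : ℝ}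
    (p : ENNReal) [Fact (1 ≤ p)] (hp : p ≠ ⊤) (c : E) :
    Continuous fun s => indicatorConstLp p (μ := volume.restrict (Icc a b))
      (measurableSet_Iic (a := s)) (measure_ne_top _ _) c := by
  refine continuous_iff_continuousAt.2 fun s => tendsto_indicatorConstLp_set hp ?_
  have hdist : Tendsto (fun σ => ENNReal.ofReal |σ - s|) (𝓝 s) (𝓝 0) := by
    have hcont : Continuous fun σ => |σ - s| := by fun_prop
    simpa using ENNReal.tendsto_ofReal (hcont.tendsto s)
  refine tendsto_of_tendsto_of_tendsto_of_le_of_le tendsto_const_nhds hdist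
    (fun _ => zero_le) fun σ => (Measure.restrict_apply_le _ _).trans ?_
  rw [← Real.volume_interval]
  refine measure_mono fun r hr => ?_
  rcases hr with ⟨hσ, hs⟩ | ⟨hs, hσ⟩
  · exact mem_uIcc.2 (.inl ⟨(not_le.1 hs).le, hσ⟩)
  · exact mem_uIcc.2 (.inr ⟨(not_le.1 hσ).le, hs⟩)

variable {E F : Type*} [NormedAddCommGroup E] [NormedSpace ℝ E] [NormedAddCommGroup F]
  [NormedSpace ℝ F] {a b : ℝ}

theorem exists_clm_Lp_ae_eq {C : ℝ → E →L[ℝ] F} (hC : ContinuousOn C (Icc a b)) :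
    ∃ K : Lp E 2 (volume.restrict (Icc a b)) →L[ℝ] Lp F 2 (volume.restrict (Icc a b)),
      ∀ u, ∀ᵐ r ∂volume.restrict (Icc a b), K u r = C r (u r) := by
  obtain ⟨M, hM⟩ := isCompact_Icc.exists_bound_of_continuousOn hC
  have hC' : MemLp C ⊤ (volume.restrict (Icc a b)) :=
    memLp_top_of_bound (hC.aestronglyMeasurable measurableSet_Icc) M
      ((ae_restrict_iff' measurableSet_Icc).2 (ae_of_all _ hM))
  let app := ContinuousLinearMap.id ℝ (E →L[ℝ] F)
  refine ⟨app.holderL _ ⊤ 2 2 (hC'.toLp C), fun u => ?_⟩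
  filter_upwards [app.coeFn_holder (r := 2) (hC'.toLp C) u, hC'.coeFn_toLp] with r hr hCr
  exact hr.trans (by rw [hCr]; rfl)

theorem exists_continuous_primitive_clm [CompleteSpace F] :
    ∃ N : ℝ → Lp F 2 (volume.restrict (Icc a b)) →L[ℝ] F, Continuous N ∧
      ∀ s ∈ Icc a b, ∀ g, N s g = ∫ r in a..s, g r := by
  refine ⟨fun s => (ContinuousLinearMap.lsmul ℝ ℝ).lpPairing _ 2 2
    (indicatorConstLp 2 measurableSet_Iic (measure_ne_top _ _) (1 : ℝ)),
    (ContinuousLinearMap.continuous _).comp (continuous_indicatorConstLp_Iic 2 (by simp) 1),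
    fun s hs g => ?_⟩
  rw [ContinuousLinearMap.lpPairing_eq_integral, intervalIntegral.integral_of_le hs.1,
    ← integral_Icc_eq_integral_Ioc]
  calc _ = ∫ r in Icc a b, (Iic s).indicator g r := by
        refine integral_congr_ae ?_
        filter_upwards [indicatorConstLp_coeFn (p := 2) (hs := measurableSet_Iic (a := s))
          (hμs := measure_ne_top (volume.restrict (Icc a b)) _) (c := (1 : ℝ))] with r hr
        rw [hr]
        by_cases h : r ∈ Iic s <;> simp [h]
    _ = ∫ r in Icc a s, g r := by
        rw [setIntegral_indicator measurableSet_Iic]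
        congr 2
        ext r
        exact ⟨fun h => ⟨h.1.1, h.2⟩, fun h => ⟨⟨h.1, h.2.trans hs.2⟩, h.2⟩⟩

theorem exists_continuous_integral_clm_apply [CompleteSpace F] {C : ℝ → E →L[ℝ] F}
    (hC : ContinuousOn C (Icc a b)) :
    ∃ N : ℝ → Lp E 2 (volume.restrict (Icc a b)) →L[ℝ] F, Continuous N ∧
      ∀ s ∈ Icc a b, ∀ u, N s u = ∫ r in a..s, C r (u r) := by
  obtain ⟨K, hK⟩ := exists_clm_Lp_ae_eq hC
  obtain ⟨N, hN, hNint⟩ := exists_continuous_primitive_clm (F := F) (a := a) (b := b)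
  refine ⟨fun s => N s ∘L K, hN.clm_comp continuous_const, fun s hs u => ?_⟩
  rw [ContinuousLinearMap.comp_apply, hNint s hs]
  refine intervalIntegral.integral_congr_ae ?_
  filter_upwards [(ae_restrict_iff' measurableSet_Icc).1 (hK u)] with r hr hrs
  exact hr (uIoc_subset_uIcc.trans (uIcc_subset_Icc (left_mem_Icc.2 (hs.1.trans hs.2)) hs) hrs)

end IntegralOperators

section SecondDerivative

open Filter Topology

theorem exists_eventually_forall_norm_le_of_continuousOn {X H F : Type*}
    [TopologicalSpace X] [TopologicalSpace H] [NormedAddCommGroup F] {K : Set X} (hK : IsCompact K)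
    {g : X → H → F} (hg : ContinuousOn (fun p : X × H => g p.1 p.2) (K ×ˢ univ)) (u : H) :
    ∃ C, ∀ᶠ v in 𝓝 u, ∀ s ∈ K, ‖g s v‖ ≤ C := by
  obtain ⟨C, hC⟩ := hK.exists_bound_of_continuousOn
    (hg.comp (continuousOn_id.prodMk continuousOn_const) fun s hs => ⟨hs, mem_univ u⟩)
  have hnear : ∀ s ∈ K, ∀ᶠ z : H × X in 𝓝 (u, s), z.2 ∈ K → ‖g z.2 z.1‖ ≤ C + 1 := by
    intro s hs
    have hlt : ∀ᶠ p in 𝓝[K ×ˢ univ] (s, u), ‖g p.1 p.2‖ < C + 1 :=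
      (hg (s, u) ⟨hs, mem_univ u⟩).norm.eventually_lt_const ((hC s hs).trans_lt (lt_add_one C))
    filter_upwards [continuous_swap.tendsto (u, s) (eventually_nhdsWithin_iff.1 hlt)] with z hz hzK
    exact (hz ⟨hzK, mem_univ _⟩).le
  refine ⟨C + 1, ?_⟩
  filter_upwards [hK.eventually_forall_of_forall_eventually
    (P := fun v s => s ∈ K → ‖g s v‖ ≤ C + 1) hnear] with v hv s hs
  exact hv s hs hs

variable {E F H : Type*} [NormedAddCommGroup E] [NormedSpace ℝ E] [NormedAddCommGroup F]
  [NormedSpace ℝ F] [NormedAddCommGroup H] [NormedSpace ℝ H]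

/-- `f` is differentiable and `f''` is the derivative of `fderiv ℝ f`: twice Fréchet
differentiability, with the second derivative encoded as a curried bilinear map. -/
structure HasSecondFDeriv (f : E → F) (f'' : E → E →L[ℝ] E →L[ℝ] F) : Prop where
  differentiable : Differentiable ℝ f
  hasFDerivAt_fderiv : ∀ u, HasFDerivAt (fderiv ℝ f) (f'' u) u

theorem hasSecondFDeriv_of_hasFDerivAt {f : E → F} {f' : E → E →L[ℝ] F}
    {f'' : E → E →L[ℝ] E →L[ℝ] F} (hf : ∀ u, HasFDerivAt f (f' u) u)
    (hf' : ∀ u, HasFDerivAt f' (f'' u) u) : HasSecondFDeriv f f'' :=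
  ⟨fun u => (hf u).differentiableAt, (funext fun u => (hf u).fderiv : fderiv ℝ f = f') ▸ hf'⟩

theorem hasSecondFDeriv_of_contDiff {f : E → F} (hf : ContDiff ℝ 2 f) :
    HasSecondFDeriv f (fderiv ℝ (fderiv ℝ f)) :=
  ⟨hf.differentiable two_ne_zero, fun u =>
    ((hf.fderiv_right (m := 1) le_rfl).differentiable one_ne_zero u).hasFDerivAt⟩

theorem hasSecondFDeriv_linear_add_quadratic (l : E →L[ℝ] F) (q : E →L[ℝ] E →L[ℝ] F) :
    HasSecondFDeriv (fun u => l u + q u u) fun _ => q + q.flip :=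
  hasSecondFDeriv_of_hasFDerivAt (f' := fun u => l + (q + q.flip) u)
    (fun u => (l.hasFDerivAt.add (q.hasFDerivAt.clm_apply (hasFDerivAt_id u))).congr_fderiv
      (by ext; simp))
    fun _ => (ContinuousLinearMap.hasFDerivAt _).const_add l

theorem hasFDerivAt_comp_const_add {f : E → F} (hf : Differentiable ℝ f) (x : E) (L : H →L[ℝ] E)
    (u : H) : HasFDerivAt (fun u => f (x + L u)) (fderiv ℝ f (x + L u) ∘L L) u :=
  (hf (x + L u)).hasFDerivAt.comp u (L.hasFDerivAt.const_add x)

namespace HasSecondFDeriv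

theorem add {f g : E → F} {f'' g'' : E → E →L[ℝ] E →L[ℝ] F} (hf : HasSecondFDeriv f f'')
    (hg : HasSecondFDeriv g g'') : HasSecondFDeriv (fun u => f u + g u) fun u => f'' u + g'' u :=
  hasSecondFDeriv_of_hasFDerivAt
    (fun u => (hf.differentiable u).hasFDerivAt.add (hg.differentiable u).hasFDerivAt)
    fun u => (hf.hasFDerivAt_fderiv u).add (hg.hasFDerivAt_fderiv u)

theorem comp_const_add {f : E → F} {f'' : E → E →L[ℝ] E →L[ℝ] F} (hf : HasSecondFDeriv f f'')
    (x : E) (L : H →L[ℝ] E) :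
    HasSecondFDeriv (fun u => f (x + L u)) fun u => (f'' (x + L u)).bilinearComp L L :=
  hasSecondFDeriv_of_hasFDerivAt (fun u => hasFDerivAt_comp_const_add hf.differentiable x L u)
    fun u => (((ContinuousLinearMap.compL ℝ H E F).flip L).hasFDerivAt.comp u
      ((hf.hasFDerivAt_fderiv _).comp u (L.hasFDerivAt.const_add x))).congr_fderiv rfl

end HasSecondFDeriv

theorem HasSecondFDeriv.exists_hasFDerivAt_gradient {H : Type*} [NormedAddCommGroup H]
    [InnerProductSpace ℝ H] [CompleteSpace H] {f : H → ℝ} {f'' : H → H →L[ℝ] H →L[ℝ] ℝ}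
    (hf : HasSecondFDeriv f f'') (u : H) :
    ∃ Γ : H →L[ℝ] H, HasFDerivAt (gradient f) Γ u ∧ ∀ v w, inner ℝ (Γ v) w = f'' u v w := by
  let riesz : (H →L[ℝ] ℝ) →L[ℝ] H :=
    { toFun := (InnerProductSpace.toDual ℝ H).symm
      map_add' := map_add _
      map_smul' := by simp
      cont := (InnerProductSpace.toDual ℝ H).symm.continuous }
  exact ⟨riesz ∘L f'' u, riesz.hasFDerivAt.comp u (hf.hasFDerivAt_fderiv u), fun v w =>
    InnerProductSpace.toDual_symm_apply⟩

theorem hasFDerivAt_intervalIntegral_of_continuousOn {a b : ℝ} (hab : a ≤ b) {g : ℝ → H → F}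
    {g' : ℝ → H → H →L[ℝ] F} (hg : ∀ u, ContinuousOn (fun s => g s u) (Icc a b))
    (hg' : ContinuousOn (fun p : ℝ × H => g' p.1 p.2) (Icc a b ×ˢ univ))
    (hderiv : ∀ s ∈ Icc a b, ∀ u, HasFDerivAt (g s) (g' s u) u) (u : H) :
    HasFDerivAt (fun u => ∫ s in a..b, g s u) (∫ s in a..b, g' s u) u := by
  have hgu : ContinuousOn (fun s => g' s u) (Icc a b) :=
    hg'.comp (continuousOn_id.prodMk continuousOn_const) fun s hs => ⟨hs, mem_univ _⟩
  obtain ⟨C, hC⟩ := exists_eventually_forall_norm_le_of_continuousOn isCompact_Icc hg' u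
  have hsub : uIoc a b ⊆ Icc a b := uIoc_of_le hab ▸ Ioc_subset_Icc_self
  refine intervalIntegral.hasFDerivAt_integral_of_dominated_of_fderiv_le
    (F' := fun u s => g' s u) (bound := fun _ => C) hC (.of_forall fun v => ?_) ?_ ?_ ?_
    intervalIntegrable_const (ae_of_all _ fun s hs v _ => hderiv s (hsub hs) v)
  · exact ((hg v).aestronglyMeasurable measurableSet_Icc).mono_set hsub
  · exact ((hg u).mono (uIcc_of_le hab).subset).intervalIntegrable
  · exact (hgu.aestronglyMeasurable measurableSet_Icc).mono_set hsub
  · exact ae_of_all _ fun s hs v hv => hv s (hsub hs)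

theorem hasSecondFDeriv_intervalIntegral {a b : ℝ} (hab : a ≤ b) {g : ℝ → H → F}
    {g'' : ℝ → H → H →L[ℝ] H →L[ℝ] F} (hg : ∀ u, ContinuousOn (fun s => g s u) (Icc a b))
    (hg' : ContinuousOn (fun p : ℝ × H => fderiv ℝ (g p.1) p.2) (Icc a b ×ˢ univ))
    (hg'' : ContinuousOn (fun p : ℝ × H => g'' p.1 p.2) (Icc a b ×ˢ univ))
    (hderiv : ∀ s ∈ Icc a b, HasSecondFDeriv (g s) (g'' s)) :
    HasSecondFDeriv (fun u => ∫ s in a..b, g s u) fun u => ∫ s in a..b, g'' s u :=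
  hasSecondFDeriv_of_hasFDerivAt
    (hasFDerivAt_intervalIntegral_of_continuousOn hab hg hg' fun s hs u =>
      ((hderiv s hs).differentiable u).hasFDerivAt)
    (hasFDerivAt_intervalIntegral_of_continuousOn hab
      (fun u => hg'.comp (continuousOn_id.prodMk continuousOn_const) fun _ hs => ⟨hs, mem_univ u⟩)
      hg'' fun s hs => (hderiv s hs).hasFDerivAt_fderiv)

end SecondDerivative

section IntegralFunctionals

variable {E F H : Type*} [NormedAddCommGroup E] [NormedSpace ℝ E] [NormedAddCommGroup F]
  [NormedSpace ℝ F] [NormedAddCommGroup H] [NormedSpace ℝ H]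

/-- The family `f s`, `s ∈ I`, is twice continuously differentiable in the space variable, with
derivatives jointly continuous in both variables; no smoothness in `s` is required. -/
structure IsC2InSpace (f : ℝ → E → F) (I : Set ℝ) : Prop where
  contDiff : ∀ s ∈ I, ContDiff ℝ 2 (f s)
  continuousOn : ContinuousOn (fun p : ℝ × E => f p.1 p.2) (I ×ˢ univ)
  continuousOn_fderiv : ContinuousOn (fun p : ℝ × E => fderiv ℝ (f p.1) p.2) (I ×ˢ univ)
  continuousOn_fderiv_fderiv :
    ContinuousOn (fun p : ℝ × E => fderiv ℝ (fderiv ℝ (f p.1)) p.2) (I ×ˢ univ)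

theorem contDiffOn_fderiv_slice {I : Set ℝ} {f : ℝ → E → F} {k l : WithTop ℕ∞}
    (hf : ContDiffOn ℝ l (fun p : ℝ × E => f p.1 p.2) (I ×ˢ univ)) (hkl : k + 1 ≤ l) :
    ContDiffOn ℝ k (fun p : ℝ × E => fderiv ℝ (f p.1) p.2) (I ×ˢ univ) := by
  have hext : ContDiffOn ℝ l (Function.uncurry fun p : ℝ × E => f p.1)
      ((I ×ˢ univ) ×ˢ univ) :=
    hf.comp (f := fun q : (ℝ × E) × E => (q.1.1, q.2)) (by fun_prop)
      fun q hq => ⟨hq.1.1, mem_univ _⟩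
  intro p hp
  simpa only [fderivWithin_univ] using (hext (p, p.2) ⟨hp, mem_univ _⟩).fderivWithin
    contDiff_snd.contDiffWithinAt uniqueDiffOn_univ hkl hp fun _ _ => mem_univ _

theorem isC2InSpace_of_contDiffOn {I : Set ℝ} {f : ℝ → E → F}
    (hf : ContDiffOn ℝ 2 (fun p : ℝ × E => f p.1 p.2) (I ×ˢ univ)) : IsC2InSpace f I where
  contDiff s hs := contDiffOn_univ.1 <| hf.comp (f := fun x => (s, x)) (by fun_prop)
    fun _ _ => ⟨hs, mem_univ _⟩
  continuousOn := hf.continuousOn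
  continuousOn_fderiv := (contDiffOn_fderiv_slice hf (k := 1) le_rfl).continuousOn
  continuousOn_fderiv_fderiv := (contDiffOn_fderiv_slice (f := fun s => fderiv ℝ (f s))
    (contDiffOn_fderiv_slice hf (k := 1) le_rfl) (k := 0) (zero_add 1).le).continuousOn

theorem continuousOn_bilinearComp {X : Type*} [TopologicalSpace X] {K : Set X}
    {q : X → E →L[ℝ] E →L[ℝ] F} {L : X → H →L[ℝ] E} (hq : ContinuousOn q K)
    (hL : ContinuousOn L K) : ContinuousOn (fun p => (q p).bilinearComp (L p) (L p)) K := by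
  have hleft : ContinuousOn (fun p => (q p ∘L L p).flip) K :=
    (ContinuousLinearMap.flipₗᵢ ℝ H E F).continuous.comp_continuousOn (hq.clm_comp hL)
  exact (ContinuousLinearMap.flipₗᵢ ℝ H H F).continuous.comp_continuousOn (hleft.clm_comp hL)

theorem intervalIntegral_bilinearComp_apply {a b : ℝ} (hab : a ≤ b) {q : ℝ → E →L[ℝ] E →L[ℝ] F}
    (hq : ContinuousOn q (Icc a b)) {L : ℝ → H →L[ℝ] E} (hL : ContinuousOn L (Icc a b)) (v w : H) :
    (∫ s in a..b, (q s).bilinearComp (L s) (L s)) v w = ∫ s in a..b, q s (L s v) (L s w) := by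
  have hqL := continuousOn_bilinearComp hq hL
  have ha : a ∈ Icc a b := left_mem_Icc.2 hab
  have hb : b ∈ Icc a b := right_mem_Icc.2 hab
  rw [ContinuousLinearMap.intervalIntegral_apply (intervalIntegrable_of_continuousOn_Icc hqL ha hb),
    ContinuousLinearMap.intervalIntegral_apply (intervalIntegrable_of_continuousOn_Icc
      (hqL.clm_apply continuousOn_const) ha hb)]
  rfl

theorem IsC2InSpace.continuousOn_fderiv_fderiv_path {I : Set ℝ} {f : ℝ → E → F}
    (hf : IsC2InSpace f I) {x : ℝ → E} (hx : ContinuousOn x I) :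
    ContinuousOn (fun s => fderiv ℝ (fderiv ℝ (f s)) (x s)) I :=
  hf.continuousOn_fderiv_fderiv.comp (continuousOn_id.prodMk hx) fun _ hs => ⟨hs, mem_univ _⟩

theorem IsC2InSpace.hasSecondFDeriv_integral {a b : ℝ} (hab : a ≤ b) {f : ℝ → E → F}
    (hf : IsC2InSpace f (Icc a b)) {x : ℝ → E} (hx : ContinuousOn x (Icc a b))
    {L : ℝ → H →L[ℝ] E} (hL : ContinuousOn L (Icc a b)) :
    HasSecondFDeriv (fun u => ∫ s in a..b, f s (x s + L s u)) fun u =>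
      ∫ s in a..b, (fderiv ℝ (fderiv ℝ (f s)) (x s + L s u)).bilinearComp (L s) (L s) := by
  have hfst : MapsTo Prod.fst (Icc a b ×ˢ (univ : Set H)) (Icc a b) := fun _ hp => hp.1
  have hL' : ContinuousOn (fun p : ℝ × H => L p.1) (Icc a b ×ˢ univ) :=
    hL.comp continuousOn_fst hfst
  have hpath : ContinuousOn (fun p : ℝ × H => (p.1, x p.1 + L p.1 p.2)) (Icc a b ×ˢ univ) :=
    continuousOn_fst.prodMk ((hx.comp continuousOn_fst hfst).add (hL'.clm_apply continuousOn_snd))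
  have hmaps : MapsTo (fun p : ℝ × H => (p.1, x p.1 + L p.1 p.2)) (Icc a b ×ˢ univ)
      (Icc a b ×ˢ univ) := fun p hp => ⟨hp.1, mem_univ _⟩
  refine hasSecondFDeriv_intervalIntegral hab (fun u => ?_) ?_
    (continuousOn_bilinearComp (hf.continuousOn_fderiv_fderiv.comp hpath hmaps) hL')
    fun s hs => (hasSecondFDeriv_of_contDiff (hf.contDiff s hs)).comp_const_add (x s) (L s)
  · exact (hf.continuousOn.comp hpath hmaps).comp
      (continuousOn_id.prodMk (continuousOn_const (c := u))) fun s hs => ⟨hs, mem_univ _⟩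
  · refine ((hf.continuousOn_fderiv.comp hpath hmaps).clm_comp hL').congr fun p hp => ?_
    exact (hasFDerivAt_comp_const_add ((hf.contDiff p.1 hp.1).differentiable two_ne_zero)
      (x p.1) (L p.1) p.2).fderiv

end IntegralFunctionals

section QuadraticForms

variable {V W H : Type*} [NormedAddCommGroup V] [InnerProductSpace ℝ V]
  [NormedAddCommGroup W] [InnerProductSpace ℝ W] [NormedAddCommGroup H] [NormedSpace ℝ H] {a b : ℝ}

theorem integrableOn_inner_of_continuousOn {p : ℝ → V} (hp : ContinuousOn p (Icc a b)) {g : ℝ → V}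
    (hg : IntegrableOn g (Icc a b)) : IntegrableOn (fun r => inner ℝ (p r) (g r)) (Icc a b) :=
  integrableOn_clm_apply_of_continuousOn ((innerSL ℝ).continuous.comp_continuousOn hp) hg

theorem exists_integral_inner_clm_apply (hab : a ≤ b) {L : ℝ → H →L[ℝ] V}
    (hL : ContinuousOn L (Icc a b)) :
    ∃ q : H →L[ℝ] Lp V 2 (volume.restrict (Icc a b)) →L[ℝ] ℝ,
      ∀ v u, q v u = ∫ r in a..b, inner ℝ (L r v) (u r) := by
  let form : V →L[ℝ] V →L[ℝ] ℝ := isBoundedBilinearMap_inner.toContinuousLinearMap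
  let C (r : ℝ) : V →L[ℝ] H →L[ℝ] ℝ := (form ∘L L r).flip
  have hC : ContinuousOn C (Icc a b) :=
    (ContinuousLinearMap.flipₗᵢ ℝ H V ℝ).continuous.comp_continuousOn
      (continuousOn_const.clm_comp hL)
  obtain ⟨N, -, hN⟩ := exists_continuous_integral_clm_apply hC
  refine ⟨(N b).flip, fun v u => ?_⟩
  rw [ContinuousLinearMap.flip_apply, hN b (right_mem_Icc.2 hab),
    ContinuousLinearMap.intervalIntegral_apply]
  · rfl
  · exact intervalIntegrable_of_integrableOn_Icc
      (integrableOn_clm_apply_of_continuousOn hC (integrableOn_Icc_Lp_two u))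
      (left_mem_Icc.2 hab) (right_mem_Icc.2 hab)

theorem exists_integral_inner_Lp (hab : a ≤ b) {R : ℝ → V →L[ℝ] W}
    (hR : ContinuousOn R (Icc a b)) :
    ∃ q : Lp V 2 (volume.restrict (Icc a b)) →L[ℝ] Lp W 2 (volume.restrict (Icc a b)) →L[ℝ] ℝ,
      ∀ u v, q u v = ∫ r in a..b, inner ℝ (R r (u r)) (v r) := by
  obtain ⟨K, hK⟩ := exists_clm_Lp_ae_eq hR
  refine ⟨isBoundedBilinearMap_inner.toContinuousLinearMap ∘L K, fun u v => ?_⟩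
  rw [intervalIntegral.integral_of_le hab, ← integral_Icc_eq_integral_Ioc]
  refine (L2.inner_def (𝕜 := ℝ) (K u) v).trans (integral_congr_ae ?_)
  filter_upwards [hK u] with r hr
  rw [hr]

theorem integrableOn_inner_clm_apply_Lp {R : ℝ → V →L[ℝ] W} (hR : ContinuousOn R (Icc a b))
    (u : Lp V 2 (volume.restrict (Icc a b))) (v : Lp W 2 (volume.restrict (Icc a b))) :
    IntegrableOn (fun r => inner ℝ (R r (u r)) (v r)) (Icc a b) := by
  obtain ⟨K, hK⟩ := exists_clm_Lp_ae_eq hR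
  refine (L2.integrable_inner (𝕜 := ℝ) (K u) v).congr ?_
  filter_upwards [hK u] with r hr
  rw [hr]

end QuadraticForms

section HilbertSchmidt

theorem norm_sq_eq_integral_norm_sq {V : Type*} [NormedAddCommGroup V] [InnerProductSpace ℝ V]
    {a b : ℝ} (hab : a ≤ b) (v : Lp V 2 (volume.restrict (Icc a b))) :
    ‖v‖ ^ 2 = ∫ r in a..b, ‖v r‖ ^ 2 := by
  rw [← real_inner_self_eq_norm_sq, L2.inner_def, intervalIntegral.integral_of_le hab,
    ← integral_Icc_eq_integral_Ioc]
  simp only [real_inner_self_eq_norm_sq]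

theorem memLp_of_continuousOn_of_isCompact {X E : Type*} [TopologicalSpace X] [MeasurableSpace X]
    [OpensMeasurableSpace X] [T2Space X] [NormedAddCommGroup E] [SecondCountableTopologyEither X E]
    {μ : Measure X} [IsFiniteMeasureOnCompacts μ] {K : Set X} (hK : IsCompact K)
    {f : X → E} (hf : ContinuousOn f K) (p : ENNReal) : MemLp f p (μ.restrict K) := by
  obtain ⟨C, hC⟩ := hK.exists_bound_of_continuousOn hf
  have : IsFiniteMeasure (μ.restrict K) := isFiniteMeasure_restrict.2 hK.measure_lt_top.ne
  exact MemLp.of_bound (hf.aestronglyMeasurable hK.measurableSet) C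
    ((ae_restrict_iff' hK.measurableSet).2 (ae_of_all _ hC))

theorem integral_mul_le_sqrt_mul_sqrt {X : Type*} [MeasurableSpace X] {μ : Measure X} {f g : X → ℝ}
    (hf₀ : 0 ≤ f) (hg₀ : 0 ≤ g) (hf : MemLp f 2 μ) (hg : MemLp g 2 μ) :
    ∫ x, f x * g x ∂μ ≤ √(∫ x, f x ^ 2 ∂μ) * √(∫ x, g x ^ 2 ∂μ) := by
  simpa [Real.sqrt_eq_rpow] using integral_mul_le_Lp_mul_Lq_of_nonneg
    Real.HolderConjugate.two_two (ae_of_all μ hf₀) (ae_of_all μ hg₀) (by simpa using hf)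
    (by simpa using hg)

variable {X V W : Type*} [MeasurableSpace X] {μ : Measure X} [SFinite μ] [NormedAddCommGroup V]
  [InnerProductSpace ℝ V] [CompleteSpace V] [NormedAddCommGroup W] [InnerProductSpace ℝ W]
  [CompleteSpace W]

theorem inner_integral_clm_apply_le (M : W →L[ℝ] W) {C : X → V →L[ℝ] W} {v : X → V}
    (hC : Integrable (fun x => C x (v x)) μ) (hv : MemLp v 2 μ)
    (hk : MemLp (fun p : X × X => (C p.1).adjoint ∘L M ∘L C p.2) 2 (μ.prod μ)) :
    inner ℝ (M (∫ x, C x (v x) ∂μ)) (∫ x, C x (v x) ∂μ)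
      ≤ √(∫ x, ∫ x', ‖(C x).adjoint ∘L M ∘L C x'‖ ^ 2 ∂μ ∂μ) * ∫ x, ‖v x‖ ^ 2 ∂μ := by
  let form : W →L[ℝ] W →L[ℝ] ℝ :=
    ((isBoundedBilinearMap_inner (𝕜 := ℝ) (E := W)).toContinuousLinearMap ∘L M).flip
  let w : X × X → ℝ := fun p => ‖v p.1‖ * ‖v p.2‖
  have hv₂ : Integrable (fun x => ‖v x‖ ^ 2) μ := hv.norm.integrable_sq
  have hw₂ : ∫ p, w p ^ 2 ∂μ.prod μ = (∫ x, ‖v x‖ ^ 2 ∂μ) ^ 2 := by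
    simp only [w, mul_pow]
    rw [integral_prod_mul (fun x => ‖v x‖ ^ 2) (fun x => ‖v x‖ ^ 2), sq]
  have hw : MemLp w 2 (μ.prod μ) := by
    have hmeas : AEStronglyMeasurable w (μ.prod μ) := hv.1.norm.comp_fst.mul hv.1.norm.comp_snd
    refine (memLp_two_iff_integrable_sq hmeas).2 ?_
    simpa only [w, mul_pow] using hv₂.mul_prod hv₂
  have hpoint (p : X × X) : form (C p.1 (v p.1)) (C p.2 (v p.2))
      ≤ ‖(C p.1).adjoint ∘L M ∘L C p.2‖ * w p := by
    calc inner ℝ (M (C p.2 (v p.2))) (C p.1 (v p.1))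
        = inner ℝ (((C p.1).adjoint ∘L M ∘L C p.2) (v p.2)) (v p.1) :=
          (ContinuousLinearMap.adjoint_inner_left _ _ _).symm
      _ ≤ ‖((C p.1).adjoint ∘L M ∘L C p.2) (v p.2)‖ * ‖v p.1‖ := real_inner_le_norm _ _
      _ ≤ ‖(C p.1).adjoint ∘L M ∘L C p.2‖ * ‖v p.2‖ * ‖v p.1‖ := by
        gcongr
        exact ContinuousLinearMap.le_opNorm _ _
      _ = _ := by simp only [w]; ring
  calc inner ℝ (M (∫ x, C x (v x) ∂μ)) (∫ x, C x (v x) ∂μ)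
      = ∫ p, form (C p.1 (v p.1)) (C p.2 (v p.2)) ∂μ.prod μ := (integral_prod_bilin form hC hC).symm
    _ ≤ ∫ p, ‖(C p.1).adjoint ∘L M ∘L C p.2‖ * w p ∂μ.prod μ :=
      integral_mono (hC.op_fst_snd (by fun_prop) ⟨‖form‖, form.le_opNorm₂⟩ hC)
        (hk.norm.integrable_mul hw) hpoint
    _ ≤ √(∫ p, ‖(C p.1).adjoint ∘L M ∘L C p.2‖ ^ 2 ∂μ.prod μ) * √(∫ p, w p ^ 2 ∂μ.prod μ) :=
      integral_mul_le_sqrt_mul_sqrt (fun _ => norm_nonneg _) (fun _ => by positivity) hk.norm hw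
    _ = _ := by
      rw [integral_prod _ hk.norm.integrable_sq, hw₂, Real.sqrt_sq (by positivity)]

end HilbertSchmidt

section CompletingTheSquare

variable {V : Type*} [NormedAddCommGroup V] [InnerProductSpace ℝ V]

theorem isInvertible_of_coercive [CompleteSpace V] {R : V →L[ℝ] V} {ρ : ℝ} (hρ : 0 < ρ)
    (hR : ∀ w, ρ * ‖w‖ ^ 2 ≤ inner ℝ (R w) w) : R.IsInvertible := by
  have hunit : IsUnit R := R.isUnit_of_forall_le_norm_inner_map (c := ⟨ρ, hρ.le⟩) hρ fun w =>
    (mul_comm _ _).trans_le ((hR w).trans (le_abs_self _))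
  exact ⟨ContinuousLinearEquiv.ofUnit hunit.unit, rfl⟩

theorem two_mul_inner_add_inner_add_inner_inverse_nonneg {R : V →L[ℝ] V} (hR : R.IsPositive)
    (hinv : R.IsInvertible) {α : ℝ} (hα : 0 < α) (p v : V) :
    0 ≤ 2 * inner ℝ p v + α * inner ℝ (R v) v + α⁻¹ * inner ℝ (R.inverse p) p := by
  set z := R.inverse p
  have hRz : R z = p := hinv.self_apply_inverse p
  have hsym : inner ℝ (R v) z = inner ℝ p v := by
    rw [hR.inner_left_eq_inner_right, hRz, real_inner_comm]
  have hsquare := mul_nonneg hα.le (hR.inner_nonneg_left (v + α⁻¹ • z))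
  calc 0 ≤ α * inner ℝ (R (v + α⁻¹ • z)) (v + α⁻¹ • z) := hsquare
    _ = _ := by
      simp only [map_add, map_smul, inner_add_left, inner_add_right, real_inner_smul_left,
        real_inner_smul_right, hRz, hsym, real_inner_comm p z]
      field_simp
      ring

theorem sub_le_add_two_mul_inner_add_inner [CompleteSpace V] {W : Type*}
    [NormedAddCommGroup W] [InnerProductSpace ℝ W] [CompleteSpace W]
    {R : V →L[ℝ] V} (hR : R.IsPositive) (hinv : R.IsInvertible) {α : ℝ} (hα : 0 < α)
    {S : W →L[ℝ] V} {M : W →L[ℝ] W} {q : ℝ} {y : W}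
    (hq : 0 ≤ q + inner ℝ (M y) y - α⁻¹ * inner ℝ (S.adjoint (R.inverse (S y))) y) (v : V) :
    (1 - α) * inner ℝ (R v) v - inner ℝ (M y) y
      ≤ q + (2 * inner ℝ (S y) v + inner ℝ (R v) v) := by
  have hsquare := two_mul_inner_add_inner_add_inner_inverse_nonneg hR hinv hα (S y) v
  rw [ContinuousLinearMap.adjoint_inner_left] at hq
  linarith

end CompletingTheSquare

section Fubini

variable {a b : ℝ} {f g k φ : ℝ → ℝ}

theorem integral_mul_primitive (hab : a ≤ b) (hk : IntervalIntegrable k volume a b)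
    (hg : IntervalIntegrable g volume a b) :
    ∫ s in a..b, k s * ∫ r in a..s, g r = ∫ r in a..b, (∫ s in r..b, k s) * g r := by
  simp only [← intervalIntegral.integral_const_mul, ← intervalIntegral.integral_mul_const]
  exact integral_integral_triangle hab (hk.1.mul_prod hg.1)

theorem const_mul_integral_le_integral_of_sub_mul_primitive_le (hab : a ≤ b)
    (hf : IntervalIntegrable f volume a b) (hg : IntervalIntegrable g volume a b)
    (hk : IntervalIntegrable k volume a b) (hφ : IntervalIntegrable φ volume a b) {c : ℝ}
    (hlower : ∀ s ∈ Icc a b, c * g s ≤ f s - (∫ τ in s..b, k τ) * g s)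
    (hupper : ∀ s ∈ Icc a b, f s - k s * ∫ r in a..s, g r ≤ φ s) :
    c * ∫ s in a..b, g s ≤ ∫ s in a..b, φ s := by
  have hk_tail : ContinuousOn (fun s => ∫ τ in s..b, k τ) (uIcc a b) :=
    intervalIntegral.continuousOn_primitive_interval_left ((intervalIntegrable_iff' (by simp)).1 hk)
  have hg_primitive : ContinuousOn (fun s => ∫ r in a..s, g r) (uIcc a b) :=
    intervalIntegral.continuousOn_primitive_interval ((intervalIntegrable_iff' (by simp)).1 hg)
  have hi_tail := hg.continuousOn_mul hk_tail
  have hi_primitive := hk.mul_continuousOn hg_primitive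
  calc c * ∫ s in a..b, g s = ∫ s in a..b, c * g s :=
        (intervalIntegral.integral_const_mul c g).symm
    _ ≤ ∫ s in a..b, (f s - (∫ τ in s..b, k τ) * g s) :=
      intervalIntegral.integral_mono_on hab (hg.const_mul c) (hf.sub hi_tail) hlower
    _ = ∫ s in a..b, (f s - k s * ∫ r in a..s, g r) := by
      rw [intervalIntegral.integral_sub hf hi_tail, ← integral_mul_primitive hab hk hg,
        intervalIntegral.integral_sub hf hi_primitive]
    _ ≤ ∫ s in a..b, φ s :=
      intervalIntegral.integral_mono_on hab (hf.sub hi_primitive) hφ hupper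

end Fubini

namespace AQProblem

section AffineResponse

variable {n m : ℕ} {P : AQProblem n m} {t T : ℝ} {A : ℝ → Vec n →L[ℝ] Vec n}
  {B : ℝ → Vec m →L[ℝ] Vec n} {S : ℝ → Vec n →L[ℝ] Vec m} {R : ℝ → Vec m →L[ℝ] Vec m}

/-- On `[t, T]` the problem has linear dynamics `A(s) x + B(s) u` and a control cost
`⟨S(s) x, u⟩ + ½ ⟨R(s) u, u⟩` with continuous matrices, `R(s)` being symmetric. -/
structure IsLinearOn (P : AQProblem n m) (t T : ℝ) (A : ℝ → Vec n →L[ℝ] Vec n)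
    (B : ℝ → Vec m →L[ℝ] Vec n) (S : ℝ → Vec n →L[ℝ] Vec m) (R : ℝ → Vec m →L[ℝ] Vec m) :
    Prop where
  A_apply : ∀ s ∈ Icc t T, ∀ x, P.A s x = A s x
  B_apply : ∀ s ∈ Icc t T, ∀ x, P.B s x = B s
  S_apply : ∀ s ∈ Icc t T, ∀ x, P.S s x = S s x
  R_apply : ∀ s ∈ Icc t T, ∀ x, P.R s x = R s
  continuousOn_A : ContinuousOn A (Icc t T)
  continuousOn_B : ContinuousOn B (Icc t T)
  continuousOn_S : ContinuousOn S (Icc t T)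
  continuousOn_R : ContinuousOn R (Icc t T)
  isSelfAdjoint_R : ∀ s ∈ Icc t T, IsSelfAdjoint (R s)

/-- The state depends affinely on the control: the trajectory is the free motion `X₀` plus the
response `Y s u = ∫_t^s Φ_A(s, r) B(r) u(r) dr`. -/
structure IsAffineResponse (P : AQProblem n m) (t T : ℝ) (A : ℝ → Vec n →L[ℝ] Vec n)
    (B : ℝ → Vec m →L[ℝ] Vec n) (x : Vec n) (X₀ : ℝ → Vec n)
    (Y : ℝ → Control m t T →L[ℝ] Vec n) : Prop where
  continuousOn_free : ContinuousOn X₀ (Icc t T)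
  continuousOn_response : ContinuousOn Y (Icc t T)
  response_apply : ∀ s ∈ Icc t T, ∀ u,
    Y s u = ∫ r in t..s, fundamentalMatrix A t T s r (B r (u r))
  isTrajectory : ∀ u, P.IsTrajectory t T x u fun s => X₀ s + Y s u

namespace IsLinearOn

theorem drift_eq (h : P.IsLinearOn t T A B S R) {s : ℝ} (hs : s ∈ Icc t T) (y : Vec n)
    (w : Vec m) : P.A s y + P.B s y w = A s y + B s w := by
  rw [h.A_apply s hs, h.B_apply s hs]

theorem integral_drift_eq (h : P.IsLinearOn t T A B S R) (X : ℝ → Vec n) (u : Control m t T)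
    {s : ℝ} (hs : s ∈ Icc t T) :
    ∫ r in t..s, (P.A r (X r) + P.B r (X r) (u r)) = ∫ r in t..s, (A r (X r) + B r (u r)) :=
  intervalIntegral.integral_congr fun _ hr =>
    h.drift_eq (uIcc_subset_Icc (left_mem_Icc.2 (hs.1.trans hs.2)) hs hr) _ _

theorem intervalIntegrable_input (h : P.IsLinearOn t T A B S R) (u : Control m t T) {s : ℝ}
    (hs : s ∈ Icc t T) : IntervalIntegrable (fun r => B r (u r)) volume t s :=
  intervalIntegrable_of_integrableOn_Icc
    (integrableOn_clm_apply_of_continuousOn h.continuousOn_B (integrableOn_Icc_Lp_two u))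
    (left_mem_Icc.2 (hs.1.trans hs.2)) hs

theorem isTrajectory (h : P.IsLinearOn t T A B S R) (htT : t ≤ T) {x : Vec n} {u : Control m t T}
    {X : ℝ → Vec n} (hX : ContinuousOn X (Icc t T))
    (hXeq : ∀ s ∈ Icc t T, X s = x + ∫ r in t..s, (A r (X r) + B r (u r))) :
    P.IsTrajectory t T x u X := by
  have hT : T ∈ Icc t T := right_mem_Icc.2 htT
  refine ⟨hX, ?_, fun s hs => (hXeq s hs).trans (by rw [h.integral_drift_eq X u hs])⟩
  refine (intervalIntegrable_congr fun r hr => ?_).2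
    ((intervalIntegrable_of_continuousOn_Icc (h.continuousOn_A.clm_apply hX)
      (left_mem_Icc.2 htT) hT).add (h.intervalIntegrable_input u hT))
  exact h.drift_eq (Ioc_subset_Icc_self (uIoc_of_le htT ▸ hr)) _ _

theorem exists_isAffineResponse (h : P.IsLinearOn t T A B S R) (htT : t ≤ T) (x : Vec n) :
    ∃ X₀ Y, P.IsAffineResponse t T A B x X₀ Y := by
  obtain ⟨Ψ, Ξ, hΨΞ⟩ := exists_isFundamentalPair htT h.continuousOn_A
  have hΞB : ContinuousOn (fun r => Ξ r ∘L B r) (Icc t T) :=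
    hΨΞ.continuousOn_inv.clm_comp h.continuousOn_B
  obtain ⟨N, hN, hNint⟩ := exists_continuous_integral_clm_apply hΞB
  have hY : ContinuousOn (fun s => Ψ s ∘L N s) (Icc t T) :=
    hΨΞ.continuousOn.clm_comp hN.continuousOn
  have hX₀ : ContinuousOn (fun s => Ψ s x) (Icc t T) :=
    hΨΞ.continuousOn.clm_apply continuousOn_const
  refine ⟨fun s => Ψ s x, fun s => Ψ s ∘L N s, hX₀, hY, fun s hs u => ?_, fun u => ?_⟩
  · rw [ContinuousLinearMap.comp_apply, hNint s hs u,
      ← (Ψ s).intervalIntegral_comp_comm (intervalIntegrable_of_integrableOn_Icc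
        (integrableOn_clm_apply_of_continuousOn hΞB (integrableOn_Icc_Lp_two u))
        (left_mem_Icc.2 htT) hs)]
    refine intervalIntegral.integral_congr fun r hr => ?_
    have hr : r ∈ Icc t s := uIcc_of_le hs.1 ▸ hr
    simp only [hΨΞ.fundamentalMatrix_eq h.continuousOn_A hr.1 hr.2 hs.2,
      ContinuousLinearMap.comp_apply]
  · refine h.isTrajectory htT (hX₀.add (hY.clm_apply continuousOn_const)) fun s hs => ?_
    have hsplit : ∀ r ∈ Icc t T,
        Ψ r x + (Ψ r ∘L N r) u = Ψ r (x + ∫ σ in t..r, Ξ σ (B σ (u σ))) := by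
      intro r hr
      rw [map_add, ContinuousLinearMap.comp_apply, hNint r hr u]
      rfl
    rw [hsplit s hs, hΨΞ.variation_of_constants h.continuousOn_A
      (integrableOn_clm_apply_of_continuousOn h.continuousOn_B (integrableOn_Icc_Lp_two u)) x hs]
    congr 1
    refine intervalIntegral.integral_congr fun r hr => ?_
    simp only [hsplit r (uIcc_subset_Icc (left_mem_Icc.2 htT) hs hr)]

theorem eqOn_of_isTrajectory (h : P.IsLinearOn t T A B S R) {x : Vec n} {u : Control m t T}
    {X X' : ℝ → Vec n} (hX : P.IsTrajectory t T x u X) (hX' : P.IsTrajectory t T x u X') :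
    EqOn X X' (Icc t T) := by
  intro s hs
  have htT : t ≤ T := hs.1.trans hs.2
  have hA (Z : ℝ → Vec n) (hZ : P.IsTrajectory t T x u Z) :
      ContinuousOn (fun r => A r (Z r)) (Icc t T) := h.continuousOn_A.clm_apply hZ.1
  have hdiff : ∀ s ∈ Icc t T, X s - X' s = 0 + ∫ r in t..s, A r (X r - X' r) := by
    intro s hs
    have hi (Z : ℝ → Vec n) (hZ : P.IsTrajectory t T x u Z) :=
      (intervalIntegrable_of_continuousOn_Icc (hA Z hZ) (left_mem_Icc.2 htT) hs).add
        (h.intervalIntegrable_input u hs)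
    rw [hX.2.2 s hs, hX'.2.2 s hs, h.integral_drift_eq X u hs, h.integral_drift_eq X' u hs,
      add_sub_add_left_eq_sub, zero_add, ← intervalIntegral.integral_sub (hi X hX) (hi X' hX')]
    simp only [map_sub, add_sub_add_right_eq_sub]
  have hderiv : ∀ s ∈ Icc t T,
      HasDerivWithinAt (fun s => X s - X' s) (A s (X s - X' s)) (Icc t T) s := fun s hs =>
    (hasDerivWithinAt_const_add_integral_Icc
      (h.continuousOn_A.clm_apply (hX.1.sub hX'.1)) 0 hs).congr hdiff (hdiff s hs)
  exact sub_eq_zero.1 (eqOn_zero_of_hasDerivWithinAt_linear h.continuousOn_A hderiv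
    (by simpa using hdiff t (left_mem_Icc.2 htT)) hs)

theorem trajectory_eqOn (h : P.IsLinearOn t T A B S R) {x : Vec n} {u : Control m t T}
    {X : ℝ → Vec n} (hX : P.IsTrajectory t T x u X) :
    EqOn (P.trajectory t T x u) X (Icc t T) := by
  have hex : ∃ X, P.IsTrajectory t T x u X := ⟨X, hX⟩
  rw [trajectory, dif_pos hex]
  exact h.eqOn_of_isTrajectory hex.choose_spec hX

end IsLinearOn

end AffineResponse

section SecondVariation

variable {n m : ℕ}

/-- The second variation of the cost along the trajectory `X` in the direction `v`, where `y` is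
the linear response of the state to `v`. -/
noncomputable def secondVariation (P : AQProblem n m) (t T : ℝ) (S : ℝ → Vec n →L[ℝ] Vec m)
    (R : ℝ → Vec m →L[ℝ] Vec m) (X y : ℝ → Vec n) (v : Control m t T) : ℝ :=
  (∫ s in t..T, (hessianForm (P.Q s) (X s) (y s)
      + (2 * inner ℝ (S s (y s)) (v s) + inner ℝ (R s (v s)) (v s))))
    + hessianForm P.G (X T) (y T)

variable {P : AQProblem n m} {t T : ℝ} {A : ℝ → Vec n →L[ℝ] Vec n} {B : ℝ → Vec m →L[ℝ] Vec n}
  {S : ℝ → Vec n →L[ℝ] Vec m} {R : ℝ → Vec m →L[ℝ] Vec m} {x : Vec n} {X₀ : ℝ → Vec n}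
  {Y : ℝ → Control m t T →L[ℝ] Vec n}

namespace IsAffineResponse

theorem continuousOn_state (hY : P.IsAffineResponse t T A B x X₀ Y) (u : Control m t T) :
    ContinuousOn (fun s => X₀ s + Y s u) (Icc t T) :=
  hY.continuousOn_free.add (hY.continuousOn_response.clm_apply continuousOn_const)

theorem continuousOn_response_apply (hY : P.IsAffineResponse t T A B x X₀ Y)
    (u : Control m t T) : ContinuousOn (fun s => Y s u) (Icc t T) :=
  hY.continuousOn_response.clm_apply continuousOn_const

end IsAffineResponse

theorem IsLinearOn.intervalIntegrable_inner_S (h : P.IsLinearOn t T A B S R) (htT : t ≤ T)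
    {z : ℝ → Vec n} (hz : ContinuousOn z (Icc t T)) (u : Control m t T) :
    IntervalIntegrable (fun s => inner ℝ (S s (z s)) (u s)) volume t T :=
  intervalIntegrable_of_integrableOn_Icc (integrableOn_inner_of_continuousOn
    (h.continuousOn_S.clm_apply hz) (integrableOn_Icc_Lp_two u)) (left_mem_Icc.2 htT)
    (right_mem_Icc.2 htT)

theorem IsLinearOn.intervalIntegrable_inner_R (h : P.IsLinearOn t T A B S R) (htT : t ≤ T)
    (u : Control m t T) : IntervalIntegrable (fun s => inner ℝ (R s (u s)) (u s)) volume t T :=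
  intervalIntegrable_of_integrableOn_Icc (integrableOn_inner_clm_apply_Lp h.continuousOn_R u u)
    (left_mem_Icc.2 htT) (right_mem_Icc.2 htT)

theorem intervalIntegrable_hessianForm (htT : t ≤ T) (hQ : IsC2InSpace P.Q (Icc t T))
    {X y : ℝ → Vec n} (hX : ContinuousOn X (Icc t T)) (hy : ContinuousOn y (Icc t T)) :
    IntervalIntegrable (fun s => hessianForm (P.Q s) (X s) (y s)) volume t T :=
  intervalIntegrable_of_continuousOn_Icc
    (((hQ.continuousOn_fderiv_fderiv_path hX).clm_apply hy).clm_apply hy) (left_mem_Icc.2 htT)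
    (right_mem_Icc.2 htT)

theorem IsLinearOn.cost_eq (h : P.IsLinearOn t T A B S R) (htT : t ≤ T)
    (hY : P.IsAffineResponse t T A B x X₀ Y)
    (hQ : ContinuousOn (fun p : ℝ × Vec n => P.Q p.1 p.2) (Icc t T ×ˢ univ)) (u : Control m t T) :
    P.cost t T x u = (∫ s in t..T, P.Q s (X₀ s + Y s u))
      + ((∫ s in t..T, inner ℝ (S s (X₀ s)) (u s)) + ((∫ s in t..T, inner ℝ (S s (Y s u)) (u s))
        + 1 / 2 * ∫ s in t..T, inner ℝ (R s (u s)) (u s)))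
      + P.G (X₀ T + Y T u) := by
  have hT : T ∈ Icc t T := right_mem_Icc.2 htT
  have hX := h.trajectory_eqOn (hY.isTrajectory u)
  have hiQ : IntervalIntegrable (fun s => P.Q s (X₀ s + Y s u)) volume t T :=
    intervalIntegrable_of_continuousOn_Icc
      (hQ.comp (continuousOn_id.prodMk (hY.continuousOn_state u)) fun s hs => ⟨hs, mem_univ _⟩)
      (left_mem_Icc.2 htT) hT
  have hiS₀ := h.intervalIntegrable_inner_S htT hY.continuousOn_free u
  have hiSY := h.intervalIntegrable_inner_S htT (hY.continuousOn_response_apply u) u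
  have hiR := (h.intervalIntegrable_inner_R htT u).const_mul (1 / 2)
  rw [cost, hX hT, ← intervalIntegral.integral_const_mul,
    ← intervalIntegral.integral_add hiSY hiR, ← intervalIntegral.integral_add hiS₀ (hiSY.add hiR),
    ← intervalIntegral.integral_add hiQ (hiS₀.add (hiSY.add hiR))]
  congr 1
  refine intervalIntegral.integral_congr fun s hs => ?_
  have hs : s ∈ Icc t T := uIcc_of_le htT ▸ hs
  simp only [hX hs, h.S_apply s hs, h.R_apply s hs, map_add, inner_add_left, add_assoc]

theorem IsLinearOn.exists_hasSecondFDeriv_cost (h : P.IsLinearOn t T A B S R) (htT : t ≤ T)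
    (hY : P.IsAffineResponse t T A B x X₀ Y) (hQ : IsC2InSpace P.Q (Icc t T))
    (hG : ContDiff ℝ 2 P.G) :
    ∃ J'', HasSecondFDeriv (P.cost t T x) J'' ∧ ∀ u v, J'' u v v =
      P.secondVariation t T S R (fun s => X₀ s + Y s u) (fun s => Y s v) v := by
  have hT : T ∈ Icc t T := right_mem_Icc.2 htT
  obtain ⟨N, -, hN⟩ := exists_continuous_integral_clm_apply
    ((innerSL ℝ).continuous.comp_continuousOn
      (h.continuousOn_S.clm_apply hY.continuousOn_free))
  obtain ⟨qS, hqS⟩ :=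
    exists_integral_inner_clm_apply htT (h.continuousOn_S.clm_comp hY.continuousOn_response)
  obtain ⟨qR, hqR⟩ := exists_integral_inner_Lp htT h.continuousOn_R
  have hcost : P.cost t T x = fun u => (∫ s in t..T, P.Q s (X₀ s + Y s u))
      + (N T u + (qS + (1 / 2 : ℝ) • qR) u u) + P.G (X₀ T + Y T u) := by
    funext u
    rw [h.cost_eq htT hY hQ.continuousOn, add_apply, add_apply, smul_apply, smul_apply, hN T hT,
      hqS, hqR]
    rfl
  have hQ'' := hQ.hasSecondFDeriv_integral htT hY.continuousOn_free hY.continuousOn_response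
  have hG'' := (hasSecondFDeriv_of_contDiff hG).comp_const_add (X₀ T) (Y T)
  rw [hcost]
  refine ⟨_, (hQ''.add (hasSecondFDeriv_linear_add_quadratic (N T) _)).add hG'', fun u v => ?_⟩
  have hQv : (∫ s in t..T,
      (fderiv ℝ (fderiv ℝ (P.Q s)) (X₀ s + Y s u)).bilinearComp (Y s) (Y s)) v v
      = ∫ s in t..T, hessianForm (P.Q s) (X₀ s + Y s u) (Y s v) :=
    intervalIntegral_bilinearComp_apply htT
      (hQ.continuousOn_fderiv_fderiv_path (hY.continuousOn_state u)) hY.continuousOn_response v v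
  have hiS := (h.intervalIntegrable_inner_S htT (hY.continuousOn_response_apply v) v).const_mul 2
  have hiR := h.intervalIntegrable_inner_R htT v
  have hqv : (qS + (1 / 2 : ℝ) • qR + (qS + (1 / 2 : ℝ) • qR).flip) v v
      = 2 * qS v v + qR v v := by
    simp only [add_apply, smul_apply, ContinuousLinearMap.flip_apply, smul_eq_mul]
    ring
  rw [secondVariation, intervalIntegral.integral_add (intervalIntegrable_hessianForm htT hQ
    (hY.continuousOn_state u) (hY.continuousOn_response_apply v)) (hiS.add hiR),
    intervalIntegral.integral_add hiS hiR, intervalIntegral.integral_const_mul, add_apply,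
    add_apply, add_apply, add_apply, hQv, hqv, hqS, hqR]
  rfl

end SecondVariation

end AQProblem

section ResponseBounds

variable {n m : ℕ} {t T : ℝ} {A : ℝ → Vec n →L[ℝ] Vec n} {B : ℝ → Vec m →L[ℝ] Vec n}

theorem continuousOn_fundamentalMatrix_comp (hA : ContinuousOn A (Icc t T))
    (hB : ContinuousOn B (Icc t T)) {τ : ℝ} (hτ : τ ∈ Icc t T) :
    ContinuousOn (fun r => fundamentalMatrix A t T τ r ∘L B r) (Icc t τ) := by
  obtain ⟨Ψ, Ξ, hΨΞ⟩ := exists_isFundamentalPair (hτ.1.trans hτ.2) hA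
  have hcont : ContinuousOn (fun r => (Ψ τ ∘L Ξ r) ∘L B r) (Icc t τ) :=
    (continuousOn_const.clm_comp (hΨΞ.continuousOn_inv.mono (Icc_subset_Icc_right hτ.2))).clm_comp
      (hB.mono (Icc_subset_Icc_right hτ.2))
  exact hcont.congr fun r hr => by simp only [hΨΞ.fundamentalMatrix_eq hA hr.1 hr.2 hτ.2]

theorem kernelNorm_nonneg (M : Vec n →L[ℝ] Vec n) (τ : ℝ) : 0 ≤ kernelNorm A B t T M τ :=
  Real.sqrt_nonneg _

theorem inner_integral_fundamentalMatrix_le_kernelNorm (hA : ContinuousOn A (Icc t T))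
    (hB : ContinuousOn B (Icc t T)) (M : Vec n →L[ℝ] Vec n) (v : Control m t T) {τ : ℝ}
    (hτ : τ ∈ Icc t T) :
    inner ℝ (M (∫ r in t..τ, fundamentalMatrix A t T τ r (B r (v r))))
        (∫ r in t..τ, fundamentalMatrix A t T τ r (B r (v r)))
      ≤ kernelNorm A B t T M τ * ∫ r in t..τ, ‖v r‖ ^ 2 := by
  let C (r : ℝ) : Vec m →L[ℝ] Vec n := fundamentalMatrix A t T τ r ∘L B r
  have hC : ContinuousOn C (Icc t τ) := continuousOn_fundamentalMatrix_comp hA hB hτ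
  have hsub : Icc t τ ⊆ Icc t T := Icc_subset_Icc_right hτ.2
  have hv : MemLp v 2 (volume.restrict (Icc t τ)) :=
    (Lp.memLp v).mono_measure (Measure.restrict_mono_set _ hsub)
  have hCv : IntegrableOn (fun r => C r (v r)) (Icc t τ) :=
    integrableOn_clm_apply_of_continuousOn hC ((integrableOn_Icc_Lp_two v).mono_set hsub)
  have hkernel : ContinuousOn (fun p : ℝ × ℝ => (C p.1).adjoint ∘L M ∘L C p.2)
      (Icc t τ ×ˢ Icc t τ) :=
    (ContinuousLinearMap.adjoint.continuous.comp_continuousOn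
      (hC.comp continuousOn_fst fun _ hp => hp.1)).clm_comp
      (continuousOn_const.clm_comp (hC.comp continuousOn_snd fun _ hp => hp.2))
  have hk := memLp_of_continuousOn_of_isCompact (μ := (volume : Measure ℝ).prod volume)
    (isCompact_Icc.prod isCompact_Icc) hkernel 2
  rw [← Measure.prod_restrict] at hk
  have hbound := inner_integral_clm_apply_le M hCv hv hk
  simp only [kernelNorm, intervalIntegral.integral_of_le hτ.1, ← integral_Icc_eq_integral_Ioc]
  simpa only [C, ContinuousLinearMap.comp_apply, ContinuousLinearMap.adjoint_comp,
    ContinuousLinearMap.comp_assoc] using hbound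

end ResponseBounds

section Coercivity

variable {n m : ℕ} {t T α δ : ℝ} {A : ℝ → Vec n →L[ℝ] Vec n} {B : ℝ → Vec m →L[ℝ] Vec n}
  {S : ℝ → Vec n →L[ℝ] Vec m} {R : ℝ → Vec m →L[ℝ] Vec m} {Qbar : ℝ → Vec n →L[ℝ] Vec n}
  {Gbar : Vec n →L[ℝ] Vec n}

theorem GHat_add_QHat_nonneg {s : ℝ} (hs : s ≤ T) :
    0 ≤ GHat A B t T Gbar + QHat A B t T Qbar s :=
  add_nonneg (kernelNorm_nonneg Gbar T)
    (intervalIntegral.integral_nonneg hs fun τ _ => kernelNorm_nonneg (Qbar τ) τ)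

namespace AQProblem

variable {P : AQProblem n m} {x : Vec n} {X₀ : ℝ → Vec n} {Y : ℝ → Control m t T →L[ℝ] Vec n}

theorem IsLinearOn.isPositive_and_isInvertible_R (h : P.IsLinearOn t T A B S R) (hα1 : α < 1)
    (hδ : 0 < δ) {s : ℝ} (hs : s ∈ Icc t T)
    (hlarge : ∀ w : Vec m, δ * ‖w‖ ^ 2 ≤ (1 - α) * inner ℝ (R s w) w
      - (GHat A B t T Gbar + QHat A B t T Qbar s) * ‖w‖ ^ 2) :
    (R s).IsPositive ∧ (R s).IsInvertible := by
  have hα : 0 < 1 - α := sub_pos.2 hα1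
  have hρ : 0 < δ / (1 - α) := div_pos hδ hα
  have hR (w : Vec m) : δ / (1 - α) * ‖w‖ ^ 2 ≤ inner ℝ (R s w) w := by
    rw [div_mul_eq_mul_div, div_le_iff₀' hα]
    exact (hlarge w).trans
      (sub_le_self _ (mul_nonneg (GHat_add_QHat_nonneg hs.2) (sq_nonneg _)))
  exact ⟨(ContinuousLinearMap.isPositive_iff' _).2
    ⟨h.isSelfAdjoint_R s hs, fun w => le_trans (by positivity) (hR w)⟩,
    isInvertible_of_coercive hρ hR⟩

theorem IsAffineResponse.inner_response_le_kernelNorm (hY : P.IsAffineResponse t T A B x X₀ Y)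
    (h : P.IsLinearOn t T A B S R) (M : Vec n →L[ℝ] Vec n) (v : Control m t T) {s : ℝ}
    (hs : s ∈ Icc t T) :
    inner ℝ (M (Y s v)) (Y s v) ≤ kernelNorm A B t T M s * ∫ r in t..s, ‖v r‖ ^ 2 := by
  rw [hY.response_apply s hs]
  exact inner_integral_fundamentalMatrix_le_kernelNorm h.continuousOn_A h.continuousOn_B M v hs

theorem IsLinearOn.le_secondVariation (h : P.IsLinearOn t T A B S R) (htT : t ≤ T)
    (hY : P.IsAffineResponse t T A B x X₀ Y) (hQ : IsC2InSpace P.Q (Icc t T)) (hα0 : 0 < α)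
    (hα1 : α < 1) (hδ : 0 < δ)
    (hQxx : ∀ s ∈ Icc t T, ∀ z y : Vec n, 0 ≤ hessianForm (P.Q s) z y + inner ℝ (Qbar s y) y
      - α⁻¹ * inner ℝ ((S s).adjoint ((R s).inverse (S s y))) y)
    (hGxx : ∀ z y : Vec n, 0 ≤ hessianForm P.G z y + inner ℝ (Gbar y) y)
    (hint : IntervalIntegrable (fun τ => kernelNorm A B t T (Qbar τ) τ) volume t T)
    (hlarge : ∀ s ∈ Icc t T, ∀ w : Vec m, δ * ‖w‖ ^ 2 ≤ (1 - α) * inner ℝ (R s w) w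
      - (GHat A B t T Gbar + QHat A B t T Qbar s) * ‖w‖ ^ 2) {X : ℝ → Vec n}
    (hX : ContinuousOn X (Icc t T)) (v : Control m t T) :
    δ * ‖v‖ ^ 2 ≤ P.secondVariation t T S R X (fun s => Y s v) v := by
  have hT : T ∈ Icc t T := right_mem_Icc.2 htT
  have hiv : IntervalIntegrable (fun s => ‖v s‖ ^ 2) volume t T :=
    intervalIntegrable_of_integrableOn_Icc (Lp.memLp v).norm.integrable_sq (left_mem_Icc.2 htT) hT
  have hiR := h.intervalIntegrable_inner_R htT v
  have hYv := hY.continuousOn_response_apply v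
  have hirun := (intervalIntegrable_hessianForm htT hQ hX hYv).add
    (((h.intervalIntegrable_inner_S htT hYv v).const_mul 2).add hiR)
  have hterminal : -(GHat A B t T Gbar * ‖v‖ ^ 2) ≤ hessianForm P.G (X T) (Y T v) := by
    have hbound := hY.inner_response_le_kernelNorm h Gbar v hT
    rw [← norm_sq_eq_integral_norm_sq htT v] at hbound
    have hconvex := hGxx (X T) (Y T v)
    rw [GHat]
    linarith
  have hrunning : ∀ s ∈ Icc t T,
      (1 - α) * inner ℝ (R s (v s)) (v s) - kernelNorm A B t T (Qbar s) s * ∫ r in t..s, ‖v r‖ ^ 2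
        ≤ hessianForm (P.Q s) (X s) (Y s v)
          + (2 * inner ℝ (S s (Y s v)) (v s) + inner ℝ (R s (v s)) (v s)) := by
    intro s hs
    obtain ⟨hpos, hinv⟩ := h.isPositive_and_isInvertible_R hα1 hδ hs (hlarge s hs)
    exact (sub_le_sub_left (hY.inner_response_le_kernelNorm h (Qbar s) v hs) _).trans
      (sub_le_add_two_mul_inner_add_inner hpos hinv hα0 (hQxx s hs _ _) (v s))
  have hlower : ∀ s ∈ Icc t T, (δ + GHat A B t T Gbar) * ‖v s‖ ^ 2
      ≤ (1 - α) * inner ℝ (R s (v s)) (v s) - QHat A B t T Qbar s * ‖v s‖ ^ 2 := by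
    intro s hs
    linarith [hlarge s hs (v s)]
  have hsum := const_mul_integral_le_integral_of_sub_mul_primitive_le htT (hiR.const_mul (1 - α))
    hiv hint hirun hlower hrunning
  rw [← norm_sq_eq_integral_norm_sq htT v] at hsum
  rw [secondVariation]
  linarith

end AQProblem

end Coercivity

namespace AQProblem

variable {n m : ℕ} {P : AQProblem n m} {t T : ℝ} {A : ℝ → Vec n →L[ℝ] Vec n}
  {B : ℝ → Vec m →L[ℝ] Vec n} {S : ℝ → Vec n →L[ℝ] Vec m} {R : ℝ → Vec m →L[ℝ] Vec m}

theorem isLinearOn_of_H1_of_H2 (ht : 0 ≤ t) (h1 : P.H1 T) (h2 : P.H2 T)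
    (hA : ∀ s ∈ Icc 0 T, ∀ x, P.A s x = A s x) (hB : ∀ s ∈ Icc 0 T, ∀ x, P.B s x = B s)
    (hS : ∀ s ∈ Icc 0 T, ∀ x, P.S s x = S s x) (hR : ∀ s ∈ Icc 0 T, ∀ x, P.R s x = R s) :
    P.IsLinearOn t T A B S R := by
  have hsub : Icc t T ⊆ Icc 0 T := Icc_subset_Icc_left ht
  have hslice {F : Type} [TopologicalSpace F] {f : ℝ → Vec n → F} {g : ℝ → F} (x : Vec n)
      (hf : ContinuousOn (fun p : ℝ × Vec n => f p.1 p.2) (Icc 0 T ×ˢ univ))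
      (hfg : ∀ s ∈ Icc 0 T, f s x = g s) : ContinuousOn g (Icc t T) :=
    (hf.comp (f := fun s => (s, x)) (by fun_prop) fun s hs => ⟨hsub hs, mem_univ _⟩).congr
      fun s hs => (hfg s (hsub hs)).symm
  obtain ⟨hAc, hBc, -⟩ := h1
  obtain ⟨-, hSc, hRc, -, hRself, -⟩ := h2
  exact
    { A_apply := fun s hs => hA s (hsub hs)
      B_apply := fun s hs => hB s (hsub hs)
      S_apply := fun s hs => hS s (hsub hs)
      R_apply := fun s hs => hR s (hsub hs)
      continuousOn_A := continuousOn_clm_apply.2 fun x => hslice x hAc fun s hs => hA s hs x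
      continuousOn_B := hslice 0 hBc fun s hs => hB s hs 0
      continuousOn_S := continuousOn_clm_apply.2 fun x => hslice x hSc fun s hs => hS s hs x
      continuousOn_R := hslice 0 hRc fun s hs => hR s hs 0
      isSelfAdjoint_R := fun s hs => hR s (hsub hs) 0 ▸ hRself s (hsub hs) 0 }

end AQProblem

theorem proposition5p4_general {n m : ℕ} {P : AQProblem n m} {T t : ℝ} (htT : t ≤ T)
    {A : ℝ → Vec n →L[ℝ] Vec n} {B : ℝ → Vec m →L[ℝ] Vec n} {S : ℝ → Vec n →L[ℝ] Vec m}
    {R : ℝ → Vec m →L[ℝ] Vec m} (h : P.IsLinearOn t T A B S R) (hQ : IsC2InSpace P.Q (Icc t T))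
    (hG : ContDiff ℝ 2 P.G) {α δ : ℝ} (hα0 : 0 < α) (hα1 : α < 1) (hδ : 0 < δ)
    {Qbar : ℝ → Vec n →L[ℝ] Vec n} {Gbar : Vec n →L[ℝ] Vec n}
    (hQxx : ∀ s ∈ Icc t T, ∀ x y : Vec n, 0 ≤ hessianForm (P.Q s) x y + inner ℝ (Qbar s y) y
      - α⁻¹ * inner ℝ ((S s).adjoint ((R s).inverse (S s y))) y)
    (hGxx : ∀ x y : Vec n, 0 ≤ hessianForm P.G x y + inner ℝ (Gbar y) y)
    (hint : IntervalIntegrable (fun τ => kernelNorm A B t T (Qbar τ) τ) volume t T)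
    (hlarge : ∀ s ∈ Icc t T, ∀ w : Vec m, δ * ‖w‖ ^ 2 ≤ (1 - α) * inner ℝ (R s w) w
      - (GHat A B t T Gbar + QHat A B t T Qbar s) * ‖w‖ ^ 2) (x : Vec n) :
    (∀ u : Control m t T, ∃ X, P.IsTrajectory t T x u X ∧
      ∀ X', P.IsTrajectory t T x u X' → EqOn X' X (Icc t T)) ∧
    Differentiable ℝ (P.cost t T x) ∧ Differentiable ℝ (P.DuJ t T x) ∧
    ∀ u v : Control m t T, δ * ‖v‖ ^ 2 ≤ inner ℝ (P.DuuJ t T x u v) v := by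
  obtain ⟨X₀, Y, hY⟩ := h.exists_isAffineResponse htT x
  obtain ⟨J'', hJ'', hJ''_eq⟩ := h.exists_hasSecondFDeriv_cost htT hY hQ hG
  choose Γ hΓ hΓ_eq using hJ''.exists_hasFDerivAt_gradient
  refine ⟨fun u => ⟨_, hY.isTrajectory u, fun X' hX' =>
      h.eqOn_of_isTrajectory hX' (hY.isTrajectory u)⟩,
    hJ''.differentiable, fun u => (hΓ u).differentiableAt, fun u v => ?_⟩
  calc δ * ‖v‖ ^ 2 ≤ P.secondVariation t T S R (fun s => X₀ s + Y s u) (fun s => Y s v) v :=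
        h.le_secondVariation htT hY hQ hα0 hα1 hδ hQxx hGxx hint hlarge (hY.continuousOn_state u) v
    _ = inner ℝ (Γ u v) v := by rw [hΓ_eq, hJ''_eq]
    _ = inner ℝ (P.DuuJ t T x u v) v := by rw [AQProblem.DuuJ, ← (hΓ u).fderiv]; rfl

theorem proposition5p4 {n m : ℕ} (P : AQProblem n m) (T t : ℝ) (ht : 0 ≤ t) (htT : t ≤ T)
    (h1 : P.H1 T) (h2 : P.H2 T) (h3 : P.H3 T)
    -- the linear structure of the coefficients
    (A : ℝ → (Vec n →L[ℝ] Vec n)) (B : ℝ → (Vec m →L[ℝ] Vec n))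
    (S : ℝ → (Vec n →L[ℝ] Vec m)) (R : ℝ → (Vec m →L[ℝ] Vec m))
    (hA : ∀ s ∈ Set.Icc 0 T, ∀ x : Vec n, P.A s x = A s x)
    (hB : ∀ s ∈ Set.Icc 0 T, ∀ x : Vec n, P.B s x = B s)
    (hS : ∀ s ∈ Set.Icc 0 T, ∀ x : Vec n, P.S s x = S s x)
    (hR : ∀ s ∈ Set.Icc 0 T, ∀ x : Vec n, P.R s x = R s)
    (α δ : ℝ) (hα0 : 0 < α) (hα1 : α < 1) (hδ : 0 < δ)
    (Qbar : ℝ → (Vec n →L[ℝ] Vec n)) (Gbar : Vec n →L[ℝ] Vec n)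
    (hQbar : ∀ s ∈ Set.Icc 0 T, (Qbar s).IsPositive) (hGbar : Gbar.IsPositive)
    -- semi-convexity
    (hQxx : ∀ s ∈ Set.Icc t T, ∀ x h : Vec n,
      0 ≤ hessianForm (P.Q s) x h + inner ℝ (Qbar s h) h
        - α⁻¹ * inner ℝ ((S s).adjoint ((R s).inverse (S s h))) h)
    (hGxx : ∀ x h : Vec n, 0 ≤ hessianForm P.G x h + inner ℝ (Gbar h) h)
    -- the integral defining `Q̂` exists
    (hint : IntervalIntegrable (fun τ => kernelNorm A B t T (Qbar τ) τ) MeasureTheory.volume t T)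
    -- `R` is large enough
    (hlarge : ∀ s ∈ Set.Icc t T, ∀ w : Vec m,
      δ * ‖w‖ ^ 2 ≤ (1 - α) * inner ℝ (R s w) w
        - (GHat A B t T Gbar + QHat A B t T Qbar s) * ‖w‖ ^ 2) :
    ∀ x : Vec n,
      -- the state equation is well-posed, so that `J(t, x; ·)` is defined
      (∀ u : Control m t T, ∃ X, P.IsTrajectory t T x u X ∧
        ∀ X', P.IsTrajectory t T x u X' → Set.EqOn X' X (Set.Icc t T)) ∧
      -- `J(t, x; ·)` is twice Fréchet differentiable on `L²(t, T; ℝᵐ)`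
      Differentiable ℝ (P.cost t T x) ∧ Differentiable ℝ (P.DuJ t T x) ∧
      -- `D_uu J(t, x; u) ≥ δ I`, uniformly in `u`
      ∀ u v : Control m t T, δ * ‖v‖ ^ 2 ≤ inner ℝ (P.DuuJ t T x u v) v :=
  proposition5p4_general htT (AQProblem.isLinearOn_of_H1_of_H2 ht h1 h2 hA hB hS hR)
    (isC2InSpace_of_contDiffOn (h3.2.2.1.mono (Set.prod_mono_left (Set.Icc_subset_Icc_left ht))))
    h3.2.2.2.2.2 hα0 hα1 hδ hQxx hGxx hint hlarge
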